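/- **Conventions.** For a semi-Riemannian manifold $(M,g)$ of class $C^\infty$ and dimension $n\ge 3$, with Levi-Civita connection $\nabla$, put $(X\wedge_g Y)Z=g(Y,Z)X-g(X,Z)Y$, $\mathcal R(X,Y)Z=\nabla_X\nabla_YZ-\nabla_Y\nabla_XZ-\nabla_{[X,Y]}Z$, $R(X_1,X_2,X_3,X_4)=g(\mathcal R(X_1,X_2)X_3,X_4)$, $G(X_1,X_2,X_3,X_4)=g((X_1\wedge_gX_2)X_3,X_4)$, $S(X,Y)=\operatorname{tr}\{Z\mapsto\mathcal R(Z,X)Y\}$, and let $\kappa$ be the trace of $S$ with respect to $g$. Let $$(R\cdot R)(X_1,\dots,X_4,X,Y)=-\sum_{i=1}^4R(\dots,\mathcal R(X,Y)X_i,\dots),\qquad Q(g,R)(X_1,\dots,X_4,X,Y)=-\sum_{i=1}^4R(\dots,(X\wedge_gY)X_i,\dots),$$ where the displayed argument replaces $X_i$. The manifold is *pseudosymmetric* if $R\cdot R$ and $Q(g,R)$ are linearly dependent at every point; then $R\cdot R=L_R\,Q(g,R)$ on $\mathcal U_R=\{x\in M: R-\frac{\kappa}{n(n-1)}G\ne0\text{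 at }x\}$ for a unique function $L_R$ on $\mathcal U_R$. It is *pseudosymmetric of constant type* if moreover $L_R$ is constant on $\mathcal U_R$. **Proposition 4.2.** Let $n\ge4$, let $C,D,p,q$ be real numbers with $p\neq 0$, and let $\widehat M\subset\mathbb R^2$ be an open set with coordinates $(x^1,x^2)$. Let $b=b(x^1)$ and $B=B(x^2)$ be smooth functions with $b$, $b'$, $Db-4C$, $1+qb$ and $B$ nowhere zero on $\widehat M$, let $B''/B=C$, and put $$a=\frac{(b')^2}{b\,(Db-4C)},\qquad F=b(x^1)\,B(x^2)^2,\qquad \overline F=\frac{p}{1+qb}\,F .$$ Let $(\widetilde N,\widetilde g)$ be a semi-Riemannian manifold of dimension $n-2$ with scalar curvature $\widetilde\kappa$, of constant curvature if $n\ge5$, such that $$\frac{\widetilde\kappa}{(n-3)(n-2)}\neq (B')^2-C B^2$$ at every point of $\widehat M\times\widetilde N$. On $\widehat M\times\widetilde N$ consider the warped product metrics $$g=a\,(dx^1)^2+b\,(dx^2)^2+F\,\widetilde g,\qquad \overline g=\frac{p\,a}{(1+qb)^2}(dx^1)^2+\frac{p\,b}{1+qb}(dx^2)^2+\overline F\,\widetilde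 g ,$$ and denote by $L_R,\kappa$ and $L_{\overline R},\overline\kappa$ the function above and the scalar curvature of $g$ and of $\overline g$. Then both manifolds are pseudosymmetric, $\mathcal U_R$ and $\mathcal U_{\overline R}$ are the whole manifold $\widehat M\times\widetilde N$, and $$L_R=-\frac D4,\qquad L_{\overline R}=-\frac{D+4qC}{4p},$$ so both are pseudosymmetric of constant type. Moreover, at every point, $$L_R-\frac{\kappa}{n(n-1)}=\frac{p}{1+qb}\left(L_{\overline R}-\frac{\overline\kappa}{n(n-1)}\right).$$ -/

import Mathlib

open scoped ContDiff Manifold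

set_option maxSynthPendingDepth 3

noncomputable section

namespace SemiRiem

section Local

/-! ### Metrics in local coordinates

`E` is the coordinate space and `h : E → (E →L[ℝ] E →L[ℝ] ℝ)` is the coordinate expression of a
metric: `h u v w = ∑ h_ij(u) v^i w^j`. Everything below is evaluated at a coordinate point `u`. -/

variable {E : Type*} [NormedAddCommGroup E] [NormedSpace ℝ E]

/-- Christoffel symbols of the first kind:
`(v, w, z) ↦ 1/2 (∂_v h(w,z) + ∂_w h(v,z) - ∂_z h(v,w))`. -/
def christoffelLower (h : E → E →L[ℝ] E →L[ℝ] ℝ) (u : E) : E →L[ℝ] E →L[ℝ] E →L[ℝ] ℝ :=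
  (1 / 2 : ℝ) • (fderiv ℝ h u + (fderiv ℝ h u).flip
    - ((ContinuousLinearMap.flipₗᵢ ℝ E E ℝ).toContinuousLinearEquiv :
        (E →L[ℝ] E →L[ℝ] ℝ) →L[ℝ] (E →L[ℝ] E →L[ℝ] ℝ)).comp (fderiv ℝ h u).flip)

theorem christoffelLower_apply (h : E → E →L[ℝ] E →L[ℝ] ℝ) (u v w z : E) :
    christoffelLower h u v w z =
      1 / 2 * (fderiv ℝ h u v w z + fderiv ℝ h u w v z - fderiv ℝ h u z v w) := by
  simp [christoffelLower]

/-- Christoffel symbols of the second kind, `Γ(v, w) = (∑ Γ^h_ij v^i w^j)_h`: the index is raised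
with the inverse of `h u : E → E*`. -/
def christoffel (h : E → E →L[ℝ] E →L[ℝ] ℝ) (u : E) : E →L[ℝ] E →L[ℝ] E :=
  (ContinuousLinearMap.compL ℝ E (E →L[ℝ] ℝ) E (h u).inverse).comp (christoffelLower h u)

theorem christoffel_apply (h : E → E →L[ℝ] E →L[ℝ] ℝ) (u v w : E) :
    christoffel h u v w = (h u).inverse (christoffelLower h u v w) := rfl

/-- The curvature endomorphism `ℛ(X,Y)Z = ∇_X ∇_Y Z - ∇_Y ∇_X Z - ∇_[X,Y] Z`, evaluated on
coordinate (constant) vector fields. -/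
def curvOp (h : E → E →L[ℝ] E →L[ℝ] ℝ) (u X Y Z : E) : E :=
  fderiv ℝ (christoffel h) u X Y Z - fderiv ℝ (christoffel h) u Y X Z
    + christoffel h u X (christoffel h u Y Z) - christoffel h u Y (christoffel h u X Z)

/-- The curvature tensor `R(X₁,X₂,X₃,X₄) = g(ℛ(X₁,X₂)X₃,X₄)`. -/
def riem (h : E → E →L[ℝ] E →L[ℝ] ℝ) (u X₁ X₂ X₃ X₄ : E) : ℝ :=
  h u (curvOp h u X₁ X₂ X₃) X₄

/-- The endomorphism `(X ∧_A Y)Z = A(Y,Z)X - A(X,Z)Y`. -/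
def wedgeOp (A : E →L[ℝ] E →L[ℝ] ℝ) (X Y Z : E) : E :=
  A Y Z • X - A X Z • Y

/-- The tensor `G(X₁,X₂,X₃,X₄) = g((X₁ ∧_g X₂)X₃,X₄)`. -/
def tensorG (h : E → E →L[ℝ] E →L[ℝ] ℝ) (u X₁ X₂ X₃ X₄ : E) : ℝ :=
  h u (wedgeOp (h u) X₁ X₂ X₃) X₄

/-- The linear map `Z ↦ ℛ(Z,X)Y`. -/
def ricciEndo (h : E → E →L[ℝ] E →L[ℝ] ℝ) (u X Y : E) : E →ₗ[ℝ] E where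
  toFun Z := curvOp h u Z X Y
  map_add' Z W := by
    simp only [curvOp, map_add, add_apply]; abel
  map_smul' c Z := by
    simp only [curvOp, map_smul, smul_apply, RingHom.id_apply, smul_add,
      smul_sub]

/-- The Ricci tensor `S(X,Y) = tr{Z ↦ ℛ(Z,X)Y}`. -/
def ricci (h : E → E →L[ℝ] E →L[ℝ] ℝ) (u : E) : E →ₗ[ℝ] E →ₗ[ℝ] ℝ :=
  LinearMap.mk₂ ℝ (fun X Y => LinearMap.trace ℝ E (ricciEndo h u X Y))
    (fun X X' Y => by
      rw [← map_add]; congr 1; ext Z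
      simp only [ricciEndo, curvOp, map_add, add_apply, LinearMap.add_apply,
        LinearMap.coe_mk, AddHom.coe_mk]; abel)
    (fun c X Y => by
      rw [← map_smul]; congr 1; ext Z
      simp only [ricciEndo, curvOp, map_smul, smul_apply,
        LinearMap.smul_apply, LinearMap.coe_mk, AddHom.coe_mk, smul_add, smul_sub])
    (fun X Y Y' => by
      rw [← map_add]; congr 1; ext Z
      simp only [ricciEndo, curvOp, map_add, LinearMap.add_apply,
        LinearMap.coe_mk, AddHom.coe_mk]; abel)
    (fun c X Y => by
      rw [← map_smul]; congr 1; ext Z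
      simp only [ricciEndo, curvOp, map_smul,
        LinearMap.smul_apply, LinearMap.coe_mk, AddHom.coe_mk, smul_add, smul_sub])

/-- The Ricci operator `𝒮`, `g(𝒮X,Y) = S(X,Y)`. -/
def ricciOp [FiniteDimensional ℝ E] (h : E → E →L[ℝ] E →L[ℝ] ℝ) (u : E) : E →ₗ[ℝ] E where
  toFun X := (h u).inverse (LinearMap.toContinuousLinearMap (ricci h u X))
  map_add' X Y := by simp only [map_add]
  map_smul' c X := by simp only [map_smul, RingHom.id_apply]

/-- The scalar curvature `κ = tr 𝒮`. -/
def scalar [FiniteDimensional ℝ E] (h : E → E →L[ℝ] E →L[ℝ] ℝ) (u : E) : ℝ :=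
  LinearMap.trace ℝ E (ricciOp h u)

/-- The action of an endomorphism `A` on a `(0,4)`-tensor `T` as a derivation:
`-T(A X₁,X₂,X₃,X₄) - ⋯ - T(X₁,X₂,X₃,A X₄)`. -/
def derivAct (A : E → E) (T : E → E → E → E → ℝ) (X₁ X₂ X₃ X₄ : E) : ℝ :=
  - T (A X₁) X₂ X₃ X₄ - T X₁ (A X₂) X₃ X₄ - T X₁ X₂ (A X₃) X₄ - T X₁ X₂ X₃ (A X₄)

/-- The `(0,6)`-tensor `R · R`. -/
def RdotR (h : E → E →L[ℝ] E →L[ℝ] ℝ) (u : E) : E → E → E → E → E → E → ℝ :=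
  fun X₁ X₂ X₃ X₄ X Y => derivAct (curvOp h u X Y) (riem h u) X₁ X₂ X₃ X₄

/-- The Tachibana tensor `Q(g,R)`. -/
def tachibana (h : E → E →L[ℝ] E →L[ℝ] ℝ) (u : E) : E → E → E → E → E → E → ℝ :=
  fun X₁ X₂ X₃ X₄ X Y => derivAct (wedgeOp (h u) X Y) (riem h u) X₁ X₂ X₃ X₄

end Local

section Manifold

/-! ### Metrics on manifolds

A tensor on `M` at a point `P` is evaluated through its coordinate expression in the preferred
chart at `P`; this chart is also the one which identifies `TangentSpace I P` with `E`. All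
manifolds considered are without boundary. -/

variable {E : Type*} [NormedAddCommGroup E] [NormedSpace ℝ E]
  {H : Type*} [TopologicalSpace H] (I : ModelWithCorners ℝ E H)
  {M : Type*} [TopologicalSpace M] [ChartedSpace H M]

/-- A field of bilinear forms on the tangent spaces of `M`. -/
abbrev BilinField (I : ModelWithCorners ℝ E H) (M : Type*) [TopologicalSpace M]
    [ChartedSpace H M] :=
  ∀ x : M, TangentSpace I x →L[ℝ] TangentSpace I x →L[ℝ] ℝ

/-- The coordinate expression of `g` in the preferred chart `φ` at `P`: the pullback of `g` by
`φ⁻¹`, meant on the target of `φ`. -/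
def localMetric (g : BilinField I M) (P : M) : E → E →L[ℝ] E →L[ℝ] ℝ := fun u =>
  ContinuousLinearMap.bilinearComp (E := E) (F := E) (E' := E) (F' := E)
    (g ((extChartAt I P).symm u))
    (mfderiv 𝓘(ℝ, E) I (extChartAt I P).symm u)
    (mfderiv 𝓘(ℝ, E) I (extChartAt I P).symm u)

/-- `g` is a semi-Riemannian metric of class `C^∞`: symmetric, nondegenerate, and with smooth
components in the charts. -/
structure IsSemiRiemannian (g : BilinField I M) : Prop where
  symm : ∀ (P : M) (v w : TangentSpace I P), g P v w = g P w v
  nondegenerate : ∀ (P : M) (v : TangentSpace I P), (∀ w, g P v w = 0) → v = 0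
  smooth : ∀ P : M, ContDiffOn ℝ ∞ (localMetric I g P) (extChartAt I P).target

/-- The curvature tensor `R` at `P`. -/
def riemAt (g : BilinField I M) (P : M) : E → E → E → E → ℝ :=
  riem (localMetric I g P) (extChartAt I P P)

/-- The tensor `G` at `P`. -/
def tensorGAt (g : BilinField I M) (P : M) : E → E → E → E → ℝ :=
  tensorG (localMetric I g P) (extChartAt I P P)

/-- The scalar curvature `κ` at `P`. -/
def scalarAt [FiniteDimensional ℝ E] (g : BilinField I M) (P : M) : ℝ :=
  scalar (localMetric I g P) (extChartAt I P P)

/-- The tensor `R · R` at `P`. -/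
def RdotRAt (g : BilinField I M) (P : M) : E → E → E → E → E → E → ℝ :=
  RdotR (localMetric I g P) (extChartAt I P P)

/-- The tensor `Q(g,R)` at `P`. -/
def tachibanaAt (g : BilinField I M) (P : M) : E → E → E → E → E → E → ℝ :=
  tachibana (localMetric I g P) (extChartAt I P P)

/-- `(M,g)` is a space of constant curvature: `R = K G` with a constant `K`. -/
def IsConstantCurvature (g : BilinField I M) : Prop :=
  ∃ K : ℝ, ∀ P : M, riemAt I g P = K • tensorGAt I g P

/-- The set `𝒰_R` of the points at which `R - κ / (n(n-1)) G ≠ 0`, where `n = dim M`. -/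
def setUR [FiniteDimensional ℝ E] (g : BilinField I M) : Set M :=
  {P | riemAt I g P - (scalarAt I g P /
    ((Module.finrank ℝ E : ℝ) * ((Module.finrank ℝ E : ℝ) - 1))) • tensorGAt I g P ≠ 0}

/-- `(M,g)` is a pseudosymmetric semi-Riemannian manifold: `R · R` and `Q(g,R)` are linearly
dependent at every point. -/
def IsPseudosymmetric (g : BilinField I M) : Prop :=
  IsSemiRiemannian I g ∧ ∀ P : M, ¬ LinearIndependent ℝ ![RdotRAt I g P, tachibanaAt I g P]

/-- `L` is the function `L_R` of `(M,g)`: `R · R = L Q(g,R)` on `𝒰_R` (values of `L` outside of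
`𝒰_R` are irrelevant). -/
def IsFunctionLR [FiniteDimensional ℝ E] (g : BilinField I M) (L : M → ℝ) : Prop :=
  ∀ P ∈ setUR I g, RdotRAt I g P = L P • tachibanaAt I g P

/-- `(M,g)` is pseudosymmetric of constant type: it is pseudosymmetric and `L_R` is constant on
`𝒰_R`. -/
def IsPseudosymmetricOfConstantType [FiniteDimensional ℝ E] (g : BilinField I M) : Prop :=
  IsPseudosymmetric I g ∧ ∃ c : ℝ, IsFunctionLR I g (fun _ => c)

end Manifold

section Warped

variable {E : Type*} [NormedAddCommGroup E] [NormedSpace ℝ E]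
  {H : Type*} [TopologicalSpace H] (I : ModelWithCorners ℝ E H)
  {M : Type*} [TopologicalSpace M] [ChartedSpace H M]
  {E' : Type*} [NormedAddCommGroup E'] [NormedSpace ℝ E']
  {H' : Type*} [TopologicalSpace H'] (J : ModelWithCorners ℝ E' H')
  {N : Type*} [TopologicalSpace N] [ChartedSpace H' N]

/-- The warped product metric `π₁^* g₁ + (F ∘ π₁) π₂^* g₂` on `M × N`. The differentials of the
projections are the projections of `T_x M × T_y N`. -/
def warped (g₁ : BilinField I M) (F : M → ℝ) (g₂ : BilinField J N) :
    BilinField (I.prod J) (M × N) := fun P =>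
  ContinuousLinearMap.bilinearComp (E := E) (F := E) (E' := E × E') (F' := E × E')
      (g₁ P.1) (ContinuousLinearMap.fst ℝ E E') (ContinuousLinearMap.fst ℝ E E')
    + F P.1 • ContinuousLinearMap.bilinearComp (E := E') (F := E') (E' := E × E') (F' := E × E')
      (g₂ P.2) (ContinuousLinearMap.snd ℝ E E') (ContinuousLinearMap.snd ℝ E E')

end Warped

/-- The metric `α (dx¹)² + β (dx²)²` on an open subset `U` of the plane with the coordinates
`x¹ = x 0`, `x² = x 1`. -/
def diagMetric (U : TopologicalSpace.Opens (EuclideanSpace ℝ (Fin 2)))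
    (α β : EuclideanSpace ℝ (Fin 2) → ℝ) : BilinField (𝓡 2) U := fun x =>
  let dx (i : Fin 2) : EuclideanSpace ℝ (Fin 2) →L[ℝ] ℝ := EuclideanSpace.proj i
  let g : EuclideanSpace ℝ (Fin 2) →L[ℝ] EuclideanSpace ℝ (Fin 2) →L[ℝ] ℝ :=
    α x • (dx 0).smulRight (dx 0) + β x • (dx 1).smulRight (dx 1)
  g

end SemiRiem

end

/-!
Write `P` for the orthogonal projection of the tangent spaces of `U × N` onto those of the fibre.
The theorem follows from the shape of the curvature tensor of `g`: at every point

  `R = λ G + μ G(P·, P·, ·, ·)`,  `λ = -D/4`,  `μ = (K - (B'² - C B²)) / F`,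

where `K = κ̃ / ((n-3)(n-2))`. Indeed, the base has constant curvature `-D/4`
(`BaseData.riem_eq`), the Hessian of `√F` is `D/4 √F ĝ` (`BaseData.hess_eq`, stated for `F` because
`F` may be negative) and `‖dF‖² = 4 F (D/4 F + B'² - C B²)` (`BaseData.grad_sq`); these are inserted
into the curvature formula of a warped product (`riem_localWarped`). The fibre satisfies `R̃ = K G̃`
pointwise, by hypothesis if its dimension is at least three and because of the symmetries of the
curvature tensor if it is a surface (`exists_riem_eq_plane`).

For such a curvature tensor (`HasSplitCurvature`), the part of `ℛ(X,Y)` which comes from `μ` is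
skew-adjoint and commutes with `P`, hence annihilates `R`, so that `R · R = λ Q(g,R)`. The tensor
`Q(g,R)` does not vanish as `μ ≠ 0`, which makes `λ` unique. Taking traces,
`κ = n(n-1) λ + (n-2)(n-3) μ`; hence `λ - κ / (n(n-1)) = -(n-2)(n-3) μ / (n(n-1))`, from which
`𝒰_R` is everything.

The metric `ḡ` is of the same kind as `g`, with the same `B` and `C`, and with `b̄ = p b / (1 + q b)`
and `D̄ = (D + 4 q C) / p` in the place of `b` and `D` (`BaseData.transform`). The last equality of
the theorem holds since `F̄ μ̄ = F μ`.

The curvature is computed in the lowered form `IsMetricNear.riem_eq`, which involves the second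
derivatives of the metric and the values of the Christoffel symbols, but no derivative of the
inverse metric.
-/

open scoped Topology

namespace SemiRiem

/-! ### The lowered curvature tensor in local coordinates -/

section Local

variable {E : Type*} [NormedAddCommGroup E] [NormedSpace ℝ E]

/-- `h` is the coordinate expression, near `u`, of a semi-Riemannian metric of class `C²`:
symmetric near `u`, and nondegenerate at `u` (hence near `u`), in the form of the invertibility of
the map `E → E*`. -/
structure IsMetricNear (h : E → E →L[ℝ] E →L[ℝ] ℝ) (u : E) : Prop where
  contDiffAt : ContDiffAt ℝ 2 h u
  symm : ∀ᶠ u' in 𝓝 u, ∀ v w, h u' v w = h u' w v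
  invertible : (h u).IsInvertible

theorem isInvertible_of_nondegenerate [FiniteDimensional ℝ E] (A : E →L[ℝ] E →L[ℝ] ℝ)
    (hA : ∀ v, (∀ w, A v w = 0) → v = 0) : A.IsInvertible := by
  have hinj : Function.Injective (A : E →ₗ[ℝ] E →L[ℝ] ℝ) := by
    refine (injective_iff_map_eq_zero _).2 fun v hv => hA v fun w => ?_
    have hv' : A v = 0 := hv
    rw [hv', zero_apply]
  have hfin : Module.finrank ℝ E = Module.finrank ℝ (E →L[ℝ] ℝ) := by
    rw [← (LinearMap.toContinuousLinearMap (𝕜 := ℝ) (E := E) (F' := ℝ)).finrank_eq]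
    exact (Subspace.dual_finrank_eq).symm
  exact ⟨(LinearEquiv.ofInjectiveOfFinrankEq _ hinj hfin).toContinuousLinearEquiv, by
    ext v w; rfl⟩

theorem nondegenerate_of_isInvertible {A : E →L[ℝ] E →L[ℝ] ℝ} (hA : A.IsInvertible) {v : E}
    (hv : ∀ w, A v w = 0) : v = 0 := by
  apply hA.injective
  ext w
  simp [hv w]

theorem christoffelLower_congr {h h' : E → E →L[ℝ] E →L[ℝ] ℝ} {u : E} (hh : h =ᶠ[𝓝 u] h') :
    christoffelLower h =ᶠ[𝓝 u] christoffelLower h' := by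
  filter_upwards [hh.fderiv (𝕜 := ℝ)] with u' hu'
  simp only [christoffelLower, hu']

theorem christoffel_congr {h h' : E → E →L[ℝ] E →L[ℝ] ℝ} {u : E} (hh : h =ᶠ[𝓝 u] h') :
    christoffel h =ᶠ[𝓝 u] christoffel h' := by
  filter_upwards [christoffelLower_congr hh, hh] with u' h1 h2
  simp only [christoffel, h1, h2]

theorem curvOp_congr {h h' : E → E →L[ℝ] E →L[ℝ] ℝ} {u : E} (hh : h =ᶠ[𝓝 u] h') :
    curvOp h u = curvOp h' u := by
  funext X Y Z
  simp only [curvOp, (christoffel_congr hh).fderiv_eq, (christoffel_congr hh).eq_of_nhds]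

theorem riem_congr {h h' : E → E →L[ℝ] E →L[ℝ] ℝ} {u : E} (hh : h =ᶠ[𝓝 u] h') :
    riem h u = riem h' u := by
  funext X Y Z W
  simp only [riem, curvOp_congr hh, hh.eq_of_nhds]

theorem riem_skew_left (h : E → E →L[ℝ] E →L[ℝ] ℝ) (u X Y Z W : E) :
    riem h u X Y Z W = - riem h u Y X Z W := by
  simp only [riem, curvOp, map_add, map_sub, add_apply, sub_apply]
  ring

theorem tensorG_congr {h h' : E → E →L[ℝ] E →L[ℝ] ℝ} {u : E} (hh : h =ᶠ[𝓝 u] h') :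
    tensorG h u = tensorG h' u := by
  funext X Y Z W
  simp only [tensorG, hh.eq_of_nhds]

theorem IsMetricNear.congr {h h' : E → E →L[ℝ] E →L[ℝ] ℝ} {u : E} (hm : IsMetricNear h u)
    (hh : h' =ᶠ[𝓝 u] h) : IsMetricNear h' u where
  contDiffAt := hm.contDiffAt.congr_of_eventuallyEq hh
  symm := by
    filter_upwards [hh, hm.symm] with u' h1 h2
    rwa [h1]
  invertible := by
    rw [hh.eq_of_nhds]
    exact hm.invertible

namespace IsMetricNear

variable {h : E → E →L[ℝ] E →L[ℝ] ℝ} {u : E}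

theorem symm_self (hm : IsMetricNear h u) (v w : E) : h u v w = h u w v :=
  hm.symm.self_of_nhds v w

theorem differentiableAt (hm : IsMetricNear h u) : DifferentiableAt ℝ h u :=
  hm.contDiffAt.differentiableAt (by norm_num)

theorem differentiableAt_fderiv (hm : IsMetricNear h u) : DifferentiableAt ℝ (fderiv ℝ h) u :=
  (hm.contDiffAt.fderiv_right (m := 1) (by norm_num)).differentiableAt (by norm_num)

theorem fderiv_symm (hm : IsMetricNear h u) :
    ∀ᶠ u' in 𝓝 u, ∀ v w z, fderiv ℝ h u' v w z = fderiv ℝ h u' v z w := by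
  have hd : ∀ᶠ u' in 𝓝 u, DifferentiableAt ℝ h u' :=
    (hm.contDiffAt.eventually (by simp)).mono fun u' h' => h'.differentiableAt (by norm_num)
  filter_upwards [hm.symm.eventually_nhds, hd] with u' h1 h2 v w z
  have key : ∀ a b : E, HasFDerivAt (fun u'' => h u'' a b)
      (((fderiv ℝ h u').flip a).flip b) u' := by
    intro a b
    have := ((h2.hasFDerivAt.clm_apply (hasFDerivAt_const a u')).clm_apply
      (hasFDerivAt_const b u'))
    exact this.congr_fderiv (by ext; simp)
  have := (key w z).unique ((key z w).congr_of_eventuallyEq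
    (h1.mono fun u'' hu'' => hu'' w z))
  have := DFunLike.congr_fun this v
  simpa using this

theorem fderiv_fderiv_comm (hm : IsMetricNear h u) (X Y : E) :
    fderiv ℝ (fderiv ℝ h) u X Y = fderiv ℝ (fderiv ℝ h) u Y X :=
  (hm.contDiffAt.isSymmSndFDerivAt (by simp)).eq X Y

theorem christoffelLower_comm (hm : IsMetricNear h u) (v w z : E) :
    christoffelLower h u v w z = christoffelLower h u w v z := by
  rw [christoffelLower_apply, christoffelLower_apply, hm.fderiv_symm.self_of_nhds z v w]
  ring

/-- The Levi-Civita connection is metric. -/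
theorem christoffelLower_add (hm : IsMetricNear h u) (v w z : E) :
    christoffelLower h u v w z + christoffelLower h u v z w = fderiv ℝ h u v w z := by
  rw [christoffelLower_apply, christoffelLower_apply, hm.fderiv_symm.self_of_nhds v w z]
  ring

theorem apply_christoffel (hm : IsMetricNear h u) (v w z : E) :
    h u (christoffel h u v w) z = christoffelLower h u v w z := by
  rw [christoffel_apply, hm.invertible.self_apply_inverse]

theorem apply_christoffel' (hm : IsMetricNear h u) (v w z : E) :
    h u z (christoffel h u v w) = christoffelLower h u v w z := by
  rw [hm.symm_self, hm.apply_christoffel]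

theorem differentiableAt_christoffelLower (hm : IsMetricNear h u) :
    DifferentiableAt ℝ (christoffelLower h) u := by
  have h1 := hm.differentiableAt_fderiv
  have h2 : DifferentiableAt ℝ (fun u' => (fderiv ℝ h u').flip) u :=
    (ContinuousLinearMap.flipₗᵢ ℝ E E (E →L[ℝ] ℝ)).toContinuousLinearEquiv.differentiableAt.comp
      u h1
  unfold christoffelLower
  exact ((h1.add h2).sub ((differentiableAt_const _).clm_comp h2)).const_smul (1 / 2 : ℝ)

theorem differentiableAt_christoffel [CompleteSpace E] (hm : IsMetricNear h u) :
    DifferentiableAt ℝ (christoffel h) u := by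
  have h1 : DifferentiableAt ℝ (fun u' => (h u').inverse) u :=
    ((hm.invertible.contDiffAt_map_inverse (n := 1)).differentiableAt (by norm_num)).comp u
      hm.differentiableAt
  unfold christoffel
  exact (((ContinuousLinearMap.compL ℝ E (E →L[ℝ] ℝ) E).differentiableAt).comp u h1).clm_comp
    hm.differentiableAt_christoffelLower

theorem fderiv_christoffelLower (hm : IsMetricNear h u) (X v w z : E) :
    fderiv ℝ (christoffelLower h) u X v w z = 1 / 2 * (fderiv ℝ (fderiv ℝ h) u X v w z
      + fderiv ℝ (fderiv ℝ h) u X w v z - fderiv ℝ (fderiv ℝ h) u X z v w) := by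
  have key : ∀ a b c : E, HasFDerivAt (fun u'' => fderiv ℝ h u'' a b c)
      ((((fderiv ℝ (fderiv ℝ h) u).flip a).flip b).flip c) u := by
    intro a b c
    have := (((hm.differentiableAt_fderiv.hasFDerivAt.clm_apply
      (hasFDerivAt_const a u)).clm_apply (hasFDerivAt_const b u)).clm_apply (hasFDerivAt_const c u))
    exact this.congr_fderiv (by ext; simp)
  have h1 := (((hm.differentiableAt_christoffelLower.hasFDerivAt.clm_apply
      (hasFDerivAt_const v u)).clm_apply (hasFDerivAt_const w u)).clm_apply (hasFDerivAt_const z u))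
  simp only [christoffelLower_apply] at h1
  have h2 := (((key v w z).add (key w v z)).sub (key z v w)).const_mul (1 / 2 : ℝ)
  have := DFunLike.congr_fun (h1.unique h2) X
  simpa using this

/-- The derivative of `Γ`, lowered: `g(∂_X Γ(v,w), z) = ∂_X Γ(v,w,z) - (∂_X g)(Γ(v,w), z)`. -/
theorem apply_fderiv_christoffel [CompleteSpace E] (hm : IsMetricNear h u) (X v w z : E) :
    h u (fderiv ℝ (christoffel h) u X v w) z = fderiv ℝ (christoffelLower h) u X v w z
      - fderiv ℝ h u X (christoffel h u v w) z := by
  -- invertibility is an open condition, so `g(Γ(v,w), z) = Γ(v,w,z)` may be differentiated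
  have hinv : ∀ᶠ u' in 𝓝 u, (h u').IsInvertible := by
    obtain ⟨e, he⟩ := hm.invertible
    have := hm.differentiableAt.continuousAt.eventually
      (by rw [← he]; exact ContinuousLinearEquiv.nhds e)
    exact this
  have h1 := ((hm.differentiableAt_christoffelLower.hasFDerivAt.clm_apply
      (hasFDerivAt_const v u)).clm_apply (hasFDerivAt_const w u)).clm_apply (hasFDerivAt_const z u)
  have h2 := ((hm.differentiableAt.hasFDerivAt.clm_apply
    ((hm.differentiableAt_christoffel.hasFDerivAt.clm_apply
      (hasFDerivAt_const v u)).clm_apply (hasFDerivAt_const w u))).clm_apply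
      (hasFDerivAt_const z u))
  have h3 := h1.unique (h2.congr_of_eventuallyEq (hinv.mono fun u' hu' => by
    simp only [christoffel_apply, hu'.self_apply_inverse]))
  have := DFunLike.congr_fun h3 X
  simp at this
  linarith

/-- The lowered curvature tensor in terms of the second derivatives of the metric and of the
Christoffel symbols; no derivative of the inverse metric occurs in it. -/
theorem riem_eq [CompleteSpace E] (hm : IsMetricNear h u) (X Y Z W : E) :
    riem h u X Y Z W =
      1 / 2 * (fderiv ℝ (fderiv ℝ h) u X Z Y W - fderiv ℝ (fderiv ℝ h) u X W Y Z
        - fderiv ℝ (fderiv ℝ h) u Y Z X W + fderiv ℝ (fderiv ℝ h) u Y W X Z)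
      - h u (christoffel h u Y Z) (christoffel h u X W)
      + h u (christoffel h u X Z) (christoffel h u Y W) := by
  simp only [riem, curvOp, map_add, map_sub, add_apply, sub_apply, hm.apply_fderiv_christoffel,
    hm.fderiv_christoffelLower, hm.apply_christoffel]
  have e : ∀ V V' : E, christoffelLower h u V W (christoffel h u V' Z)
      = christoffelLower h u V' Z (christoffel h u V W) := fun V V' => by
    rw [← hm.apply_christoffel', hm.apply_christoffel]
  rw [← hm.christoffelLower_add X, ← hm.christoffelLower_add Y, hm.fderiv_fderiv_comm X Y,
    e, e]
  ring

theorem riem_skew_right [CompleteSpace E] (hm : IsMetricNear h u) (X Y Z W : E) :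
    riem h u X Y Z W = - riem h u X Y W Z := by
  rw [hm.riem_eq, hm.riem_eq, hm.symm_self (christoffel h u Y W),
    hm.symm_self (christoffel h u X W)]
  ring

end IsMetricNear

end Local

/-! ### Warped products in local coordinates -/

section LocalWarped

variable {E₁ : Type*} [NormedAddCommGroup E₁] [NormedSpace ℝ E₁]
  {E₂ : Type*} [NormedAddCommGroup E₂] [NormedSpace ℝ E₂]

/-- The coordinate expression `h₁ + F h₂` of a warped product metric. -/
noncomputable def localWarped (h₁ : E₁ → E₁ →L[ℝ] E₁ →L[ℝ] ℝ) (F : E₁ → ℝ)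
    (h₂ : E₂ → E₂ →L[ℝ] E₂ →L[ℝ] ℝ) :
    E₁ × E₂ → (E₁ × E₂) →L[ℝ] (E₁ × E₂) →L[ℝ] ℝ := fun u =>
  (h₁ u.1).bilinearComp (ContinuousLinearMap.fst ℝ E₁ E₂) (ContinuousLinearMap.fst ℝ E₁ E₂)
    + F u.1 • (h₂ u.2).bilinearComp (ContinuousLinearMap.snd ℝ E₁ E₂)
      (ContinuousLinearMap.snd ℝ E₁ E₂)

variable {h₁ : E₁ → E₁ →L[ℝ] E₁ →L[ℝ] ℝ} {F : E₁ → ℝ} {h₂ : E₂ → E₂ →L[ℝ] E₂ →L[ℝ] ℝ}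
  {u : E₁ × E₂}

theorem localWarped_apply (u v w : E₁ × E₂) :
    localWarped h₁ F h₂ u v w = h₁ u.1 v.1 w.1 + F u.1 * h₂ u.2 v.2 w.2 := by
  simp [localWarped]

theorem _root_.ContDiffAt.bilinearComp_const {G E E' : Type*} [NormedAddCommGroup G]
    [NormedSpace ℝ G] [NormedAddCommGroup E] [NormedSpace ℝ E] [NormedAddCommGroup E']
    [NormedSpace ℝ E'] {h : G → E →L[ℝ] E →L[ℝ] ℝ} {k : WithTop ℕ∞} {x : G}
    (hh : ContDiffAt ℝ k h x) (l : E' →L[ℝ] E) :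
    ContDiffAt ℝ k (fun y => (h y).bilinearComp l l) x := by
  have h1 : ContDiffAt ℝ k (fun y => ((h y).comp l).flip) x :=
    (ContinuousLinearMap.flipₗᵢ ℝ E' E ℝ).contDiff.contDiffAt.comp x
      (hh.clm_comp contDiffAt_const)
  exact (ContinuousLinearMap.flipₗᵢ ℝ E' E' ℝ).contDiff.contDiffAt.comp x
      (h1.clm_comp contDiffAt_const)

theorem contDiffAt_localWarped {k : WithTop ℕ∞} (hh₁ : ContDiffAt ℝ k h₁ u.1)
    (hF : ContDiffAt ℝ k F u.1) (hh₂ : ContDiffAt ℝ k h₂ u.2) :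
    ContDiffAt ℝ k (localWarped h₁ F h₂) u :=
  ((hh₁.comp u contDiffAt_fst).bilinearComp_const _).add
    ((hF.comp u contDiffAt_fst).smul ((hh₂.comp u contDiffAt_snd).bilinearComp_const _))

theorem localWarped_nondegenerate {A₁ : E₁ →L[ℝ] E₁ →L[ℝ] ℝ} {A₂ : E₂ →L[ℝ] E₂ →L[ℝ] ℝ} {f : ℝ}
    (h1 : ∀ v, (∀ w, A₁ v w = 0) → v = 0) (h2 : ∀ v, (∀ w, A₂ v w = 0) → v = 0) (hf : f ≠ 0)
    {v : E₁ × E₂} (hv : ∀ w : E₁ × E₂, A₁ v.1 w.1 + f * A₂ v.2 w.2 = 0) : v = 0 := by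
  refine Prod.ext (h1 _ fun w => ?_) (h2 _ fun w => ?_)
  · simpa using hv (w, 0)
  · simpa [hf] using hv (0, w)

theorem IsMetricNear.localWarped [FiniteDimensional ℝ E₁] [FiniteDimensional ℝ E₂]
    (hh₁ : IsMetricNear h₁ u.1) (hF : ContDiffAt ℝ 2 F u.1) (hF0 : F u.1 ≠ 0)
    (hh₂ : IsMetricNear h₂ u.2) : IsMetricNear (localWarped h₁ F h₂) u where
  contDiffAt := contDiffAt_localWarped hh₁.contDiffAt hF hh₂.contDiffAt
  symm := by
    filter_upwards [continuousAt_fst.eventually hh₁.symm, continuousAt_snd.eventually hh₂.symm]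
      with u' h1 h2 v w
    rw [localWarped_apply, localWarped_apply, h1, h2]
  invertible := by
    refine isInvertible_of_nondegenerate _ fun v hv => ?_
    simp only [localWarped_apply] at hv
    exact localWarped_nondegenerate (fun v hv => nondegenerate_of_isInvertible hh₁.invertible hv)
      (fun v hv => nondegenerate_of_isInvertible hh₂.invertible hv) hF0 hv

theorem fderiv_localWarped (hh₁ : DifferentiableAt ℝ h₁ u.1) (hF : DifferentiableAt ℝ F u.1)
    (hh₂ : DifferentiableAt ℝ h₂ u.2) (hw : DifferentiableAt ℝ (localWarped h₁ F h₂) u)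
    (Y Z W : E₁ × E₂) :
    fderiv ℝ (localWarped h₁ F h₂) u Y Z W = fderiv ℝ h₁ u.1 Y.1 Z.1 W.1
      + fderiv ℝ F u.1 Y.1 * h₂ u.2 Z.2 W.2 + F u.1 * fderiv ℝ h₂ u.2 Y.2 Z.2 W.2 := by
  have d1 := (((hh₁.hasFDerivAt.comp u hasFDerivAt_fst).clm_apply
    (hasFDerivAt_const Z.1 u)).clm_apply (hasFDerivAt_const W.1 u))
  have d2 := (((hh₂.hasFDerivAt.comp u hasFDerivAt_snd).clm_apply
    (hasFDerivAt_const Z.2 u)).clm_apply (hasFDerivAt_const W.2 u))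
  have d3 := d1.add ((hF.hasFDerivAt.comp u hasFDerivAt_fst).mul d2)
  have d4 := ((hw.hasFDerivAt.clm_apply (hasFDerivAt_const Z u)).clm_apply
    (hasFDerivAt_const W u))
  simp only [localWarped_apply] at d4
  have := DFunLike.congr_fun (d4.unique d3) Y
  simp at this
  rw [this]
  ring

theorem fderiv_fderiv_localWarped [FiniteDimensional ℝ E₁] [FiniteDimensional ℝ E₂]
    (hh₁ : IsMetricNear h₁ u.1) (hF : ContDiffAt ℝ 2 F u.1) (hF0 : F u.1 ≠ 0)
    (hh₂ : IsMetricNear h₂ u.2) (X Y Z W : E₁ × E₂) :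
    fderiv ℝ (fderiv ℝ (localWarped h₁ F h₂)) u X Y Z W =
      fderiv ℝ (fderiv ℝ h₁) u.1 X.1 Y.1 Z.1 W.1
      + fderiv ℝ (fderiv ℝ F) u.1 X.1 Y.1 * h₂ u.2 Z.2 W.2
      + fderiv ℝ F u.1 Y.1 * fderiv ℝ h₂ u.2 X.2 Z.2 W.2
      + fderiv ℝ F u.1 X.1 * fderiv ℝ h₂ u.2 Y.2 Z.2 W.2
      + F u.1 * fderiv ℝ (fderiv ℝ h₂) u.2 X.2 Y.2 Z.2 W.2 := by
  have hw := hh₁.localWarped hF hF0 hh₂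
  have dF : DifferentiableAt ℝ (fderiv ℝ F) u.1 :=
    (hF.fderiv_right (m := 1) (by norm_num)).differentiableAt (by norm_num)
  have hFd : DifferentiableAt ℝ F u.1 := hF.differentiableAt (by norm_num)
  have ev : ∀ᶠ u' in 𝓝 u, DifferentiableAt ℝ h₁ u'.1 ∧ DifferentiableAt ℝ F u'.1 ∧
      DifferentiableAt ℝ h₂ u'.2 ∧ DifferentiableAt ℝ (SemiRiem.localWarped h₁ F h₂) u' := by
    filter_upwards [continuousAt_fst.eventually (hh₁.contDiffAt.eventually (by simp)),
      continuousAt_fst.eventually (hF.eventually (by simp)),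
      continuousAt_snd.eventually (hh₂.contDiffAt.eventually (by simp)),
      hw.contDiffAt.eventually (by simp)] with u' a1 a2 a3 a4
    exact ⟨a1.differentiableAt (by norm_num), a2.differentiableAt (by norm_num),
      a3.differentiableAt (by norm_num), a4.differentiableAt (by norm_num)⟩
  have d1 := ((((hh₁.differentiableAt_fderiv.hasFDerivAt.comp u hasFDerivAt_fst).clm_apply
    (hasFDerivAt_const Y.1 u)).clm_apply (hasFDerivAt_const Z.1 u)).clm_apply
    (hasFDerivAt_const W.1 u))
  have d2 := (((hh₂.differentiableAt.hasFDerivAt.comp u hasFDerivAt_snd).clm_apply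
    (hasFDerivAt_const Z.2 u)).clm_apply (hasFDerivAt_const W.2 u))
  have d3 := ((((hh₂.differentiableAt_fderiv.hasFDerivAt.comp u hasFDerivAt_snd).clm_apply
    (hasFDerivAt_const Y.2 u)).clm_apply (hasFDerivAt_const Z.2 u)).clm_apply
    (hasFDerivAt_const W.2 u))
  have d4 := (dF.hasFDerivAt.comp u hasFDerivAt_fst).clm_apply (hasFDerivAt_const Y.1 u)
  have d5 := (d1.add (d4.mul d2)).add ((hFd.hasFDerivAt.comp u hasFDerivAt_fst).mul d3)
  have d6 := ((hw.differentiableAt_fderiv.hasFDerivAt.clm_apply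
    (hasFDerivAt_const Y u)).clm_apply (hasFDerivAt_const Z u)).clm_apply (hasFDerivAt_const W u)
  have d7 := d6.unique (d5.congr_of_eventuallyEq (ev.mono fun u' ⟨a1, a2, a3, a4⟩ =>
    fderiv_localWarped a1 a2 a3 a4 Y Z W))
  have := DFunLike.congr_fun d7 X
  simp at this
  rw [this]
  ring

/-- The Christoffel symbols of a warped product; `(h₁ u.1).inverse (fderiv ℝ F u.1)` is the gradient
of `F`. -/
theorem christoffel_localWarped [FiniteDimensional ℝ E₁] [FiniteDimensional ℝ E₂]
    (hh₁ : IsMetricNear h₁ u.1) (hF : ContDiffAt ℝ 2 F u.1) (hF0 : F u.1 ≠ 0)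
    (hh₂ : IsMetricNear h₂ u.2) (v w : E₁ × E₂) :
    christoffel (localWarped h₁ F h₂) u v w =
      (christoffel h₁ u.1 v.1 w.1
        - (1 / 2 * h₂ u.2 v.2 w.2) • (h₁ u.1).inverse (fderiv ℝ F u.1),
       christoffel h₂ u.2 v.2 w.2 + (fderiv ℝ F u.1 v.1 / (2 * F u.1)) • w.2
        + (fderiv ℝ F u.1 w.1 / (2 * F u.1)) • v.2) := by
  have hw := hh₁.localWarped hF hF0 hh₂
  have hFd : DifferentiableAt ℝ F u.1 := hF.differentiableAt (by norm_num)
  apply hw.invertible.injective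
  refine ContinuousLinearMap.ext fun z => ?_
  rw [hw.apply_christoffel, localWarped_apply, christoffelLower_apply]
  simp only [fderiv_localWarped hh₁.differentiableAt hFd hh₂.differentiableAt hw.differentiableAt,
    map_sub, map_add, map_smul, sub_apply, add_apply, smul_apply, hh₁.apply_christoffel,
    hh₂.apply_christoffel, hh₁.invertible.self_apply_inverse, christoffelLower_apply, smul_eq_mul]
  rw [hh₂.symm_self w.2 z.2, hh₂.symm_self v.2 z.2, hh₂.symm_self z.2 w.2, hh₂.symm_self z.2 v.2]
  field_simp
  ring

/-- The curvature of a warped product, in terms of the `(0,2)`-tensor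
`T = Hess F - dF ⊗ dF / (2F)` and the squared length of the gradient of `F`. -/
theorem riem_localWarped [FiniteDimensional ℝ E₁] [FiniteDimensional ℝ E₂]
    (hh₁ : IsMetricNear h₁ u.1) (hF : ContDiffAt ℝ 2 F u.1) (hF0 : F u.1 ≠ 0)
    (hh₂ : IsMetricNear h₂ u.2) (T : E₁ → E₁ → ℝ)
    (hT : ∀ v w, T v w = fderiv ℝ (fderiv ℝ F) u.1 v w - fderiv ℝ F u.1 (christoffel h₁ u.1 v w)
      - fderiv ℝ F u.1 v * fderiv ℝ F u.1 w / (2 * F u.1)) (X Y Z W : E₁ × E₂) :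
    riem (localWarped h₁ F h₂) u X Y Z W =
      riem h₁ u.1 X.1 Y.1 Z.1 W.1 + F u.1 * riem h₂ u.2 X.2 Y.2 Z.2 W.2
      + 1 / 2 * (T X.1 Z.1 * h₂ u.2 Y.2 W.2 - T X.1 W.1 * h₂ u.2 Y.2 Z.2
        - T Y.1 Z.1 * h₂ u.2 X.2 W.2 + T Y.1 W.1 * h₂ u.2 X.2 Z.2)
      - 1 / 4 * fderiv ℝ F u.1 ((h₁ u.1).inverse (fderiv ℝ F u.1)) *
        tensorG h₂ u.2 X.2 Y.2 Z.2 W.2 := by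
  have hw := hh₁.localWarped hF hF0 hh₂
  have hgrad : ∀ v, h₁ u.1 ((h₁ u.1).inverse (fderiv ℝ F u.1)) v = fderiv ℝ F u.1 v := fun v => by
    rw [hh₁.invertible.self_apply_inverse]
  have hgrad' : ∀ v, h₁ u.1 v ((h₁ u.1).inverse (fderiv ℝ F u.1)) = fderiv ℝ F u.1 v := fun v => by
    rw [hh₁.symm_self, hgrad]
  rw [hw.riem_eq, hh₁.riem_eq, hh₂.riem_eq]
  -- the first derivatives of `h₂` are sums of Christoffel symbols of the first kind, which then
  -- cancel against those in the products `g(Γ, Γ)`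
  simp only [fderiv_fderiv_localWarped hh₁ hF hF0 hh₂, christoffel_localWarped hh₁ hF hF0 hh₂,
    localWarped_apply, hT, tensorG, wedgeOp, ← hh₂.christoffelLower_add,
    map_sub, map_add, map_smul, sub_apply, add_apply, smul_apply, smul_eq_mul, hgrad, hgrad',
    hh₂.apply_christoffel' _ _ X.2, hh₂.apply_christoffel' _ _ Y.2, hh₂.apply_christoffel _ _ X.2,
    hh₂.apply_christoffel _ _ Y.2, hh₂.apply_christoffel' _ _ Z.2, hh₂.apply_christoffel _ _ W.2]
  simp only [hh₂.christoffelLower_comm Y.2 X.2, hh₂.christoffelLower_comm Z.2 X.2,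
    hh₂.christoffelLower_comm W.2 X.2, hh₂.christoffelLower_comm Z.2 Y.2,
    hh₂.christoffelLower_comm W.2 Y.2, hh₂.christoffelLower_comm W.2 Z.2,
    hh₂.symm_self Z.2 X.2, hh₂.symm_self Z.2 Y.2,
    hh₂.symm_self Y.2 X.2]
  field_simp
  ring

end LocalWarped

/-! ### The base surface -/

section Base

local notation "ℰ²" => EuclideanSpace ℝ (Fin 2)

/-- The bilinear form `s (dx¹)² + t (dx²)²` on the plane. -/
noncomputable def diagForm (s t : ℝ) : ℰ² →L[ℝ] ℰ² →L[ℝ] ℝ :=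
  s • (EuclideanSpace.proj 0 : ℰ² →L[ℝ] ℝ).smulRight (EuclideanSpace.proj 0 : ℰ² →L[ℝ] ℝ)
    + t • (EuclideanSpace.proj 1 : ℰ² →L[ℝ] ℝ).smulRight (EuclideanSpace.proj 1 : ℰ² →L[ℝ] ℝ)

theorem diagForm_apply (s t : ℝ) (v w : ℰ²) :
    diagForm s t v w = s * (v 0 * w 0) + t * (v 1 * w 1) := by
  simp [diagForm]

theorem diagForm_symm (s t : ℝ) (v w : ℰ²) : diagForm s t v w = diagForm s t w v := by
  rw [diagForm_apply, diagForm_apply, mul_comm (v 0), mul_comm (v 1)]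

theorem diagForm_nondegenerate {s t : ℝ} (hs : s ≠ 0) (ht : t ≠ 0) (v : ℰ²)
    (hv : ∀ w, diagForm s t v w = 0) : v = 0 := by
  have h0 := hv (EuclideanSpace.single 0 1)
  have h1 := hv (EuclideanSpace.single 1 1)
  simp [diagForm_apply, hs, ht] at h0 h1
  ext i
  fin_cases i
  · exact h0
  · exact h1

variable {a b B : ℝ → ℝ} {u : ℰ²}

theorem contDiffAt_comp_coord {f : ℝ → ℝ} {k : WithTop ℕ∞} (i : Fin 2)
    (hf : ContDiffAt ℝ k f (u i)) : ContDiffAt ℝ k (fun x : ℰ² => f (x i)) u :=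
  ContDiffAt.comp u (g := f) hf (EuclideanSpace.proj i : ℰ² →L[ℝ] ℝ).contDiff.contDiffAt

theorem hasFDerivAt_comp_coord {f : ℝ → ℝ} (i : Fin 2) (hf : DifferentiableAt ℝ f (u i)) :
    HasFDerivAt (fun x : ℰ² => f (x i)) (deriv f (u i) • (EuclideanSpace.proj i : ℰ² →L[ℝ] ℝ)) u :=
  HasDerivAt.comp_hasFDerivAt (h₂ := f) u hf.hasDerivAt
    (EuclideanSpace.proj i : ℰ² →L[ℝ] ℝ).hasFDerivAt

theorem continuousAt_coord (i : Fin 2) : ContinuousAt (fun x : ℰ² => x i) u :=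
  (EuclideanSpace.proj i : ℰ² →L[ℝ] ℝ).continuous.continuousAt

theorem contDiffAt_deriv {f : ℝ → ℝ} {x : ℝ} {k l : WithTop ℕ∞} (hf : ContDiffAt ℝ k f x)
    (hl : l + 1 ≤ k) : ContDiffAt ℝ l (deriv f) x := by
  have : deriv f = fun y => fderiv ℝ f y 1 := by
    funext y
    exact fderiv_apply_one_eq_deriv.symm
  rw [this]
  exact (hf.fderiv_right hl).clm_apply contDiffAt_const

theorem differentiableAt_deriv {f : ℝ → ℝ} {x : ℝ} (hf : ContDiffAt ℝ 2 f x) :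
    DifferentiableAt ℝ (deriv f) x :=
  (contDiffAt_deriv (l := 1) hf (by norm_num)).differentiableAt (by norm_num)

theorem contDiffAt_diagForm {k : WithTop ℕ∞} {α β : ℰ² → ℝ} (hα : ContDiffAt ℝ k α u)
    (hβ : ContDiffAt ℝ k β u) : ContDiffAt ℝ k (fun x => diagForm (α x) (β x)) u :=
  (hα.smul contDiffAt_const).add (hβ.smul contDiffAt_const)

theorem isMetricNear_diagForm (ha : ContDiffAt ℝ 2 a (u 0)) (hb : ContDiffAt ℝ 2 b (u 0))
    (ha0 : a (u 0) ≠ 0) (hb0 : b (u 0) ≠ 0) :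
    IsMetricNear (fun x : ℰ² => diagForm (a (x 0)) (b (x 0))) u where
  contDiffAt := contDiffAt_diagForm (contDiffAt_comp_coord 0 ha) (contDiffAt_comp_coord 0 hb)
  symm := Filter.Eventually.of_forall fun _ v w => diagForm_symm _ _ v w
  invertible := isInvertible_of_nondegenerate _ (diagForm_nondegenerate ha0 hb0)

theorem fderiv_diagForm (ha : DifferentiableAt ℝ a (u 0)) (hb : DifferentiableAt ℝ b (u 0))
    (Y Z W : ℰ²) :
    fderiv ℝ (fun x : ℰ² => diagForm (a (x 0)) (b (x 0))) u Y Z W =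
      Y 0 * diagForm (deriv a (u 0)) (deriv b (u 0)) Z W := by
  have hd : DifferentiableAt ℝ (fun x : ℰ² => diagForm (a (x 0)) (b (x 0))) u :=
    ((hasFDerivAt_comp_coord 0 ha).differentiableAt.smul_const _).add
      ((hasFDerivAt_comp_coord 0 hb).differentiableAt.smul_const _)
  have d1 := ((hasFDerivAt_comp_coord 0 ha).mul_const (Z 0 * W 0)).add
    ((hasFDerivAt_comp_coord 0 hb).mul_const (Z 1 * W 1))
  have d2 := (hd.hasFDerivAt.clm_apply (hasFDerivAt_const Z u)).clm_apply (hasFDerivAt_const W u)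
  simp only [diagForm_apply] at d2
  have := DFunLike.congr_fun (d2.unique d1) Y
  simp at this
  rw [this, diagForm_apply]
  ring

theorem fderiv_fderiv_diagForm (ha : ContDiffAt ℝ 2 a (u 0)) (hb : ContDiffAt ℝ 2 b (u 0))
    (X Y Z W : ℰ²) :
    fderiv ℝ (fderiv ℝ (fun x : ℰ² => diagForm (a (x 0)) (b (x 0)))) u X Y Z W =
      X 0 * Y 0 * diagForm (deriv (deriv a) (u 0)) (deriv (deriv b) (u 0)) Z W := by
  have hd : DifferentiableAt ℝ (fderiv ℝ (fun x : ℰ² => diagForm (a (x 0)) (b (x 0)))) u :=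
    ((contDiffAt_diagForm (contDiffAt_comp_coord 0 ha) (contDiffAt_comp_coord 0 hb)).fderiv_right
      (m := 1) (by norm_num)).differentiableAt (by norm_num)
  have ev : ∀ᶠ u' in 𝓝 u, fderiv ℝ (fun x : ℰ² => diagForm (a (x 0)) (b (x 0))) u' Y Z W =
      Y 0 * (deriv a (u' 0) * (Z 0 * W 0) + deriv b (u' 0) * (Z 1 * W 1)) := by
    filter_upwards [(continuousAt_coord 0).eventually (ha.eventually (by simp)),
      (continuousAt_coord 0).eventually (hb.eventually (by simp))] with u' h1 h2
    rw [fderiv_diagForm (h1.differentiableAt (by norm_num)) (h2.differentiableAt (by norm_num)),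
      diagForm_apply]
  have d1 := (((hasFDerivAt_comp_coord 0 (differentiableAt_deriv ha)).mul_const (Z 0 * W 0)).add
    ((hasFDerivAt_comp_coord 0 (differentiableAt_deriv hb)).mul_const (Z 1 * W 1))).const_mul (Y 0)
  have d2 := ((hd.hasFDerivAt.clm_apply
    (hasFDerivAt_const Y u)).clm_apply (hasFDerivAt_const Z u)).clm_apply (hasFDerivAt_const W u)
  have := DFunLike.congr_fun (d2.unique (d1.congr_of_eventuallyEq ev)) X
  simp at this
  rw [this, diagForm_apply]
  ring

theorem christoffel_diagForm (ha : ContDiffAt ℝ 2 a (u 0)) (hb : ContDiffAt ℝ 2 b (u 0))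
    (ha0 : a (u 0) ≠ 0) (hb0 : b (u 0) ≠ 0) (v w : ℰ²) :
    christoffel (fun x : ℰ² => diagForm (a (x 0)) (b (x 0))) u v w 0 =
        (deriv a (u 0) * (v 0 * w 0) - deriv b (u 0) * (v 1 * w 1)) / (2 * a (u 0)) ∧
      christoffel (fun x : ℰ² => diagForm (a (x 0)) (b (x 0))) u v w 1 =
        deriv b (u 0) * (v 0 * w 1 + v 1 * w 0) / (2 * b (u 0)) := by
  have hm := isMetricNear_diagForm ha hb ha0 hb0
  have h0 := hm.apply_christoffel v w (EuclideanSpace.single 0 1)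
  have h1 := hm.apply_christoffel v w (EuclideanSpace.single 1 1)
  rw [christoffelLower_apply] at h0 h1
  simp only [fderiv_diagForm (ha.differentiableAt (by norm_num))
    (hb.differentiableAt (by norm_num)), diagForm_apply] at h0 h1
  simp at h0 h1
  constructor
  · field_simp; linarith
  · field_simp; linarith

/-- The squared length of a covector with respect to `diagForm s t`. -/
theorem inverse_diagForm {s t : ℝ} (hs : s ≠ 0) (ht : t ≠ 0) (l : ℰ² →L[ℝ] ℝ) :
    l ((diagForm s t).inverse l) =
      l (EuclideanSpace.single 0 1) ^ 2 / s + l (EuclideanSpace.single 1 1) ^ 2 / t := by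
  have hi := isInvertible_of_nondegenerate _ (diagForm_nondegenerate hs ht)
  set x := (diagForm s t).inverse l with hx
  have hl : diagForm s t x = l := hi.self_apply_inverse l
  rw [← hl]
  simp [diagForm_apply]
  field_simp

/-- The warping function `b(x¹) B(x²)²`. -/
noncomputable def warpFun (b B : ℝ → ℝ) (x : ℰ²) : ℝ := b (x 0) * B (x 1) ^ 2

theorem contDiffAt_warpFun {k : WithTop ℕ∞} (hb : ContDiffAt ℝ k b (u 0))
    (hB : ContDiffAt ℝ k B (u 1)) : ContDiffAt ℝ k (warpFun b B) u :=
  (contDiffAt_comp_coord 0 hb).mul ((contDiffAt_comp_coord 1 hB).pow 2)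

theorem fderiv_warpFun (hb : DifferentiableAt ℝ b (u 0)) (hB : DifferentiableAt ℝ B (u 1))
    (Y : ℰ²) : fderiv ℝ (warpFun b B) u Y =
      deriv b (u 0) * B (u 1) ^ 2 * Y 0 + 2 * b (u 0) * B (u 1) * deriv B (u 1) * Y 1 := by
  have := ((hasFDerivAt_comp_coord 0 hb).mul ((hasFDerivAt_comp_coord 1 hB).pow 2)).fderiv
  unfold warpFun
  erw [this]
  simp
  ring

theorem fderiv_fderiv_warpFun (hb : ContDiffAt ℝ 2 b (u 0)) (hB : ContDiffAt ℝ 2 B (u 1))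
    (X Y : ℰ²) : fderiv ℝ (fderiv ℝ (warpFun b B)) u X Y =
      deriv (deriv b) (u 0) * B (u 1) ^ 2 * (X 0 * Y 0)
      + 2 * deriv b (u 0) * B (u 1) * deriv B (u 1) * (X 0 * Y 1 + X 1 * Y 0)
      + 2 * b (u 0) * (deriv B (u 1) ^ 2 + B (u 1) * deriv (deriv B) (u 1)) * (X 1 * Y 1) := by
  have hd : DifferentiableAt ℝ (fderiv ℝ (warpFun b B)) u :=
    ((contDiffAt_warpFun hb hB).fderiv_right (m := 1) (by norm_num)).differentiableAt (by norm_num)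
  have ev : ∀ᶠ u' in 𝓝 u, fderiv ℝ (warpFun b B) u' Y =
      deriv b (u' 0) * B (u' 1) ^ 2 * Y 0 + 2 * b (u' 0) * B (u' 1) * deriv B (u' 1) * Y 1 := by
    filter_upwards [(continuousAt_coord 0).eventually (hb.eventually (by simp)),
      (continuousAt_coord 1).eventually (hB.eventually (by simp))] with u' h1 h2
    exact fderiv_warpFun (h1.differentiableAt (by norm_num)) (h2.differentiableAt (by norm_num)) Y
  have eb := hasFDerivAt_comp_coord 0 (hb.differentiableAt (by norm_num))
  have eB := hasFDerivAt_comp_coord 1 (hB.differentiableAt (by norm_num))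
  have eb' := hasFDerivAt_comp_coord 0 (differentiableAt_deriv hb)
  have eB' := hasFDerivAt_comp_coord 1 (differentiableAt_deriv hB)
  have d1 := ((eb'.mul (eB.pow 2)).mul_const (Y 0)).add
    ((((eb.const_mul 2).mul eB).mul eB').mul_const (Y 1))
  have d2 := hd.hasFDerivAt.clm_apply (hasFDerivAt_const Y u)
  have := DFunLike.congr_fun (d2.unique (d1.congr_of_eventuallyEq ev)) X
  simp at this
  rw [this]
  ring

/-- The pointwise data of the base: `a = b'² / (b (D b - 4 C))` near `x¹ = u 0`, `B'' = C B` at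
`x² = u 1`, and all the quantities that are required not to vanish do not vanish at `u`. -/
structure BaseData (a b B : ℝ → ℝ) (C D : ℝ) (u : ℰ²) : Prop where
  contDiffAt_b : ContDiffAt ℝ ∞ b (u 0)
  contDiffAt_B : ContDiffAt ℝ ∞ B (u 1)
  b_ne : b (u 0) ≠ 0
  deriv_b_ne : deriv b (u 0) ≠ 0
  denom_ne : D * b (u 0) - 4 * C ≠ 0
  B_ne : B (u 1) ≠ 0
  a_eq : a =ᶠ[𝓝 (u 0)] fun t => deriv b t ^ 2 / (b t * (D * b t - 4 * C))
  deriv_deriv_B : deriv (deriv B) (u 1) = C * B (u 1)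

namespace BaseData

variable {C D : ℝ}

theorem contDiffAt_a (h : BaseData a b B C D u) : ContDiffAt ℝ ∞ a (u 0) := by
  refine ContDiffAt.congr_of_eventuallyEq ?_ h.a_eq
  have hb := h.contDiffAt_b
  have hb' : ContDiffAt ℝ ∞ (deriv b) (u 0) := contDiffAt_deriv hb (by simp)
  exact (hb'.pow 2).div (hb.mul ((contDiffAt_const.mul hb).sub contDiffAt_const))
    (mul_ne_zero h.b_ne h.denom_ne)

theorem a_ne (h : BaseData a b B C D u) : a (u 0) ≠ 0 := by
  rw [h.a_eq.eq_of_nhds]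
  exact div_ne_zero (pow_ne_zero 2 h.deriv_b_ne) (mul_ne_zero h.b_ne h.denom_ne)

theorem warpFun_ne (h : BaseData a b B C D u) : warpFun b B u ≠ 0 :=
  mul_ne_zero h.b_ne (pow_ne_zero 2 h.B_ne)

theorem contDiffAt_b_two (h : BaseData a b B C D u) : ContDiffAt ℝ 2 b (u 0) :=
  h.contDiffAt_b.of_le (WithTop.coe_le_coe.2 le_top)

theorem contDiffAt_a_two (h : BaseData a b B C D u) : ContDiffAt ℝ 2 a (u 0) :=
  h.contDiffAt_a.of_le (WithTop.coe_le_coe.2 le_top)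

theorem contDiffAt_B_two (h : BaseData a b B C D u) : ContDiffAt ℝ 2 B (u 1) :=
  h.contDiffAt_B.of_le (WithTop.coe_le_coe.2 le_top)

/-- The derivative of the relation `a b (D b - 4 C) = b'²`, solved for `a'`. -/
theorem deriv_a (h : BaseData a b B C D u) :
    deriv a (u 0) = (2 * deriv b (u 0) * deriv (deriv b) (u 0) - a (u 0) * (deriv b (u 0) *
      (D * b (u 0) - 4 * C) + b (u 0) * (D * deriv b (u 0)))) /
        (b (u 0) * (D * b (u 0) - 4 * C)) := by
  have ha := (h.contDiffAt_a.differentiableAt (by simp)).hasDerivAt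
  have hb := (h.contDiffAt_b.differentiableAt (by simp)).hasDerivAt
  have hb' := (differentiableAt_deriv h.contDiffAt_b_two).hasDerivAt
  have hne : ∀ᶠ t in 𝓝 (u 0), b t * (D * b t - 4 * C) ≠ 0 :=
    ((hb.continuousAt.mul ((continuousAt_const.mul hb.continuousAt).sub
      continuousAt_const)).eventually_ne (mul_ne_zero h.b_ne h.denom_ne))
  have d1 := ha.mul (hb.mul ((hb.const_mul D).sub_const (4 * C)))
  have d2 := d1.unique ((hb'.pow 2).congr_of_eventuallyEq (by
    filter_upwards [h.a_eq, hne] with t h1 h2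
    simpa only [Pi.mul_apply, Pi.pow_apply, h1] using div_mul_cancel₀ _ h2))
  rw [eq_div_iff (mul_ne_zero h.b_ne h.denom_ne)]
  simp at d2
  linarith

theorem isMetricNear (h : BaseData a b B C D u) :
    IsMetricNear (fun x : ℰ² => diagForm (a (x 0)) (b (x 0))) u :=
  isMetricNear_diagForm h.contDiffAt_a_two h.contDiffAt_b_two h.a_ne h.b_ne

/-- The base surface has constant curvature `-D/4`. -/
theorem riem_eq (h : BaseData a b B C D u) (X Y Z W : ℰ²) :
    riem (fun x : ℰ² => diagForm (a (x 0)) (b (x 0))) u X Y Z W =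
      -D / 4 * tensorG (fun x : ℰ² => diagForm (a (x 0)) (b (x 0))) u X Y Z W := by
  have hc := christoffel_diagForm h.contDiffAt_a_two h.contDiffAt_b_two h.a_ne h.b_ne
  have hA := h.a_eq.eq_of_nhds
  have hb := h.b_ne
  have hb' := h.deriv_b_ne
  have hE := h.denom_ne
  rw [h.isMetricNear.riem_eq]
  simp only [fderiv_fderiv_diagForm h.contDiffAt_a_two h.contDiffAt_b_two, tensorG, wedgeOp,
    diagForm_apply, map_sub, map_smul, (hc _ _).1, (hc _ _).2, sub_apply, smul_apply, smul_eq_mul,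
    h.deriv_a]
  rw [hA]
  -- with a name for the denominator, the claim is an identity of rational functions
  obtain ⟨e, he⟩ : ∃ e, e = D * b (u 0) - 4 * C := ⟨_, rfl⟩
  rw [← he] at hE ⊢
  field_simp
  ring

/-- `Hess F - dF ⊗ dF / (2F)` is proportional to the metric of the base; equivalently,
`Hess √F = (D/4) √F ĝ` where `F > 0`. -/
theorem hess_eq (h : BaseData a b B C D u) (v w : ℰ²) :
    D / 2 * warpFun b B u * diagForm (a (u 0)) (b (u 0)) v w =
      fderiv ℝ (fderiv ℝ (warpFun b B)) u v w
      - fderiv ℝ (warpFun b B) u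
        (christoffel (fun x : ℰ² => diagForm (a (x 0)) (b (x 0))) u v w)
      - fderiv ℝ (warpFun b B) u v * fderiv ℝ (warpFun b B) u w / (2 * warpFun b B u) := by
  have hc := christoffel_diagForm h.contDiffAt_a_two h.contDiffAt_b_two h.a_ne h.b_ne
  have hA := h.a_eq.eq_of_nhds
  have hb := h.b_ne
  have hb' := h.deriv_b_ne
  have hE := h.denom_ne
  have hB := h.B_ne
  rw [fderiv_fderiv_warpFun h.contDiffAt_b_two h.contDiffAt_B_two]
  simp only [fderiv_warpFun (h.contDiffAt_b_two.differentiableAt (by norm_num))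
    (h.contDiffAt_B_two.differentiableAt (by norm_num)), (hc _ _).1, (hc _ _).2, diagForm_apply,
    h.deriv_a, h.deriv_deriv_B, warpFun]
  rw [hA]
  -- with a name for the denominator, the claim is an identity of rational functions
  obtain ⟨e, he⟩ : ∃ e, e = D * b (u 0) - 4 * C := ⟨_, rfl⟩
  have hC : C = (D * b (u 0) - e) / 4 := by linarith
  rw [← he] at hE ⊢
  rw [hC]
  field_simp
  ring

/-- The squared length of `dF`; equivalently, `‖d√F‖² = D/4 F + B'² - C B²` where `F > 0`. -/
theorem grad_sq (h : BaseData a b B C D u) :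
    fderiv ℝ (warpFun b B) u ((diagForm (a (u 0)) (b (u 0))).inverse (fderiv ℝ (warpFun b B) u)) =
      4 * warpFun b B u * (D / 4 * warpFun b B u + deriv B (u 1) ^ 2 - C * B (u 1) ^ 2) := by
  have hA := h.a_eq.eq_of_nhds
  have hb := h.b_ne
  have hb' := h.deriv_b_ne
  have hE := h.denom_ne
  rw [inverse_diagForm h.a_ne h.b_ne]
  simp only [fderiv_warpFun (h.contDiffAt_b_two.differentiableAt (by norm_num))
    (h.contDiffAt_B_two.differentiableAt (by norm_num)), warpFun]
  rw [hA]
  simp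
  field_simp
  ring

/-- The curvature tensor of the warped product over the base, the fibre having at the given point
the curvature tensor of a space of constant curvature `K`. -/
theorem riem_warped {E₂ : Type*} [NormedAddCommGroup E₂] [NormedSpace ℝ E₂]
    [FiniteDimensional ℝ E₂] {h₂ : E₂ → E₂ →L[ℝ] E₂ →L[ℝ] ℝ} {u : ℰ² × E₂} {K : ℝ}
    (h : BaseData a b B C D u.1) (hh₂ : IsMetricNear h₂ u.2)
    (hK : ∀ X Y Z W, riem h₂ u.2 X Y Z W = K * tensorG h₂ u.2 X Y Z W) (X Y Z W : ℰ² × E₂) :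
    riem (localWarped (fun x : ℰ² => diagForm (a (x 0)) (b (x 0))) (warpFun b B) h₂) u X Y Z W =
      -D / 4 * tensorG (localWarped (fun x : ℰ² => diagForm (a (x 0)) (b (x 0))) (warpFun b B) h₂)
        u X Y Z W
      + (K - (deriv B (u.1 1) ^ 2 - C * B (u.1 1) ^ 2)) * warpFun b B u.1 *
        tensorG h₂ u.2 X.2 Y.2 Z.2 W.2 := by
  rw [riem_localWarped h.isMetricNear (contDiffAt_warpFun h.contDiffAt_b_two h.contDiffAt_B_two)
    h.warpFun_ne hh₂ _ h.hess_eq, hK, h.riem_eq, h.grad_sq]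
  simp only [tensorG, wedgeOp, localWarped_apply, map_sub, map_smul, sub_apply, smul_apply,
    smul_eq_mul]
  ring

end BaseData

end Base

/-! ### Curvature tensors of the form `λ G + μ G(P·, P·, ·, ·)` -/

section Algebra

variable {E : Type*} [NormedAddCommGroup E] [NormedSpace ℝ E]
  {h : E → E →L[ℝ] E →L[ℝ] ℝ} {u : E} {P : E →ₗ[ℝ] E} {l μ : ℝ}

theorem tensorG_apply (h : E → E →L[ℝ] E →L[ℝ] ℝ) (u X Y Z W : E) :
    tensorG h u X Y Z W = h u Y Z * h u X W - h u X Z * h u Y W := by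
  simp [tensorG, wedgeOp]

/-- At the point `u`, the curvature tensor is `l G + μ G(P·, P·, ·, ·)`, where `P` is an orthogonal
projection of the tangent space. -/
structure HasSplitCurvature (h : E → E →L[ℝ] E →L[ℝ] ℝ) (u : E) (P : E →ₗ[ℝ] E) (l μ : ℝ) :
    Prop where
  symm : ∀ v w, h u v w = h u w v
  invertible : (h u).IsInvertible
  proj : ∀ v, P (P v) = P v
  selfAdjoint : ∀ v w, h u (P v) w = h u v (P w)
  riem_eq : ∀ X Y Z W,
    riem h u X Y Z W = l * tensorG h u X Y Z W + μ * tensorG h u (P X) (P Y) Z W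

namespace HasSplitCurvature

theorem curvOp_eq (H : HasSplitCurvature h u P l μ) (X Y Z : E) :
    curvOp h u X Y Z = l • wedgeOp (h u) X Y Z + μ • wedgeOp (h u) (P X) (P Y) Z := by
  apply H.invertible.injective
  refine ContinuousLinearMap.ext fun W => ?_
  have := H.riem_eq X Y Z W
  simp only [riem, tensorG] at this
  simpa using this

/-- `R` is annihilated by the skew-adjoint endomorphisms which preserve the splitting. -/
theorem derivAct_riem_eq_zero (H : HasSplitCurvature h u P l μ) {L : E → E}
    (hL : ∀ v w, h u v (L w) = - h u (L v) w) (hP : ∀ v, P (L v) = L (P v)) (X₁ X₂ X₃ X₄ : E) :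
    derivAct L (riem h u) X₁ X₂ X₃ X₄ = 0 := by
  simp only [derivAct, H.riem_eq, tensorG_apply, hL, hP]
  ring

theorem RdotR_eq (H : HasSplitCurvature h u P l μ) : RdotR h u = l • tachibana h u := by
  funext X₁ X₂ X₃ X₄ X Y
  -- the `G(P·, P·, ·, ·)` part of the curvature operator is skew-adjoint and commutes with `P`
  have h0 : derivAct (wedgeOp (h u) (P X) (P Y)) (riem h u) X₁ X₂ X₃ X₄ = 0 := by
    refine H.derivAct_riem_eq_zero (fun v w => ?_) (fun v => ?_) X₁ X₂ X₃ X₄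
    · simp only [wedgeOp, map_sub, map_smul, sub_apply, smul_apply, smul_eq_mul,
        H.symm v (P X), H.symm v (P Y)]
      ring
    · simp only [wedgeOp, map_sub, map_smul, H.proj, ← H.selfAdjoint]
  have h1 : RdotR h u X₁ X₂ X₃ X₄ X Y = l * tachibana h u X₁ X₂ X₃ X₄ X Y
      + μ * derivAct (wedgeOp (h u) (P X) (P Y)) (riem h u) X₁ X₂ X₃ X₄ := by
    simp only [RdotR, tachibana, derivAct, H.curvOp_eq, H.riem_eq, tensorG_apply, map_add,
      map_smul, add_apply, smul_apply, smul_eq_mul]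
    ring
  rw [h1, h0]
  simp

/-- Some components of `Q(g,R)`, with `e`, `e'` orthogonal to the image of `P` and `y` in it. -/
theorem tachibana_eq (H : HasSplitCurvature h u P l μ) {e e' y w s t : E} (he : P e = 0)
    (he' : P e' = 0) (hy : P y = y) :
    tachibana h u e w s t e' y = μ * h u e e' * tensorG h u y (P w) s t := by
  have hey : h u e y = 0 := by rw [← hy, ← H.selfAdjoint, he]; simp
  have hye : h u y e = 0 := by rw [H.symm, hey]
  simp only [tachibana, derivAct, H.riem_eq, tensorG_apply, wedgeOp, map_sub, map_smul, sub_apply,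
    smul_apply, smul_eq_mul, he, he', hy, hey, hye, map_zero, zero_apply]
  rw [H.symm e' e, H.symm w e', H.symm w y]
  ring

/-- Some components of `R - c G`, to which the second part of `R` does not contribute. -/
theorem riem_sub_apply (H : HasSplitCurvature h u P l μ) {e e' s t : E} (he : P e = 0)
    (he' : P e' = 0) (hs : P s = s) (c : ℝ) :
    riem h u e s t e' - c * tensorG h u e s t e' = (l - c) * (h u e e' * h u s t) := by
  have hse : h u s e' = 0 := by rw [← hs, H.selfAdjoint, he', map_zero]
  simp only [H.riem_eq, tensorG_apply, he, hs, hse, map_zero, zero_apply]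
  ring

/-- The metric is nondegenerate on the kernel of `P`. -/
theorem exists_apply_ne_zero (H : HasSplitCurvature h u P l μ) {e : E} (he : P e = 0)
    (he0 : e ≠ 0) : ∃ e', P e' = 0 ∧ h u e e' ≠ 0 := by
  by_contra! hc
  refine he0 (nondegenerate_of_isInvertible H.invertible fun w => ?_)
  have h1 := hc (w - P w) (by rw [map_sub, H.proj, sub_self])
  rw [map_sub, ← H.selfAdjoint, he, map_zero, zero_apply, sub_zero] at h1
  exact h1

variable [FiniteDimensional ℝ E]

theorem ricci_eq (H : HasSplitCurvature h u P l μ) (X Y : E) :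
    ricci h u X Y = l * (Module.finrank ℝ E - 1) * h u X Y
      + μ * (LinearMap.trace ℝ E P - 1) * h u (P X) Y := by
  have hX : ricciEndo h u X Y =
      l • (h u X Y • LinearMap.id - ((h u).flip Y : E →ₗ[ℝ] ℝ).smulRight X)
      + μ • (h u (P X) Y • P - (((h u).flip Y : E →ₗ[ℝ] ℝ).comp P).smulRight (P X)) := by
    ext Z
    change curvOp h u Z X Y = _
    rw [H.curvOp_eq]
    simp [wedgeOp]
  change LinearMap.trace ℝ E (ricciEndo h u X Y) = _
  rw [hX]
  simp only [map_add, map_sub, map_smul, LinearMap.trace_smulRight, LinearMap.trace_id,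
    LinearMap.comp_apply, H.proj, smul_eq_mul, ContinuousLinearMap.coe_coe,
    ContinuousLinearMap.flip_apply]
  ring

theorem scalar_eq (H : HasSplitCurvature h u P l μ) :
    scalar h u = l * (Module.finrank ℝ E * (Module.finrank ℝ E - 1))
      + μ * (LinearMap.trace ℝ E P * (LinearMap.trace ℝ E P - 1)) := by
  have hop : ricciOp h u = (l * (Module.finrank ℝ E - 1)) • LinearMap.id
      + (μ * (LinearMap.trace ℝ E P - 1)) • P := by
    ext X
    change (h u).inverse (LinearMap.toContinuousLinearMap (ricci h u X)) = _
    rw [H.invertible.inverse_apply_eq]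
    ext Y
    simp [H.ricci_eq]
  rw [scalar, hop]
  simp only [map_add, map_smul, LinearMap.trace_id, smul_eq_mul]
  ring

end HasSplitCurvature

/-- `G(v, w, ·, ·) ≠ 0` for linearly independent `v`, `w`. -/
theorem exists_tensorG_ne_zero (hA : (h u).IsInvertible) {v w : E}
    (hvw : LinearIndependent ℝ ![v, w]) : ∃ Z W, tensorG h u v w Z W ≠ 0 := by
  by_contra! hc
  rw [LinearIndependent.pair_iff] at hvw
  have hv : v ≠ 0 := fun hv => one_ne_zero (hvw 1 0 (by simp [hv])).1
  apply hv
  apply nondegenerate_of_isInvertible hA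
  intro z
  have h1 : h u w z • v - h u v z • w = 0 := by
    apply nondegenerate_of_isInvertible hA
    intro t
    simpa [tensorG_apply] using hc z t
  have := (hvw (h u w z) (-h u v z) (by rw [← h1]; module)).2
  simpa using this

/-- Constant curvature at a point is the case `P = 0`. -/
theorem HasSplitCurvature.of_riem_eq (hm : IsMetricNear h u) {K : ℝ}
    (hK : ∀ X Y Z W, riem h u X Y Z W = K * tensorG h u X Y Z W) :
    HasSplitCurvature h u 0 K 0 where
  symm := hm.symm_self
  invertible := hm.invertible
  proj _ := rfl
  selfAdjoint v w := by simp
  riem_eq X Y Z W := by simp [hK]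

end Algebra

section Plane

local notation "ℰ²" => EuclideanSpace ℝ (Fin 2)

/-- A skew-symmetric bilinear form on the plane is a multiple of the determinant. -/
theorem skew_plane_apply {φ : ℰ² → ℰ² → ℝ} (hadd : ∀ X X' Y, φ (X + X') Y = φ X Y + φ X' Y)
    (hsmul : ∀ (c : ℝ) X Y, φ (c • X) Y = c * φ X Y) (hskew : ∀ X Y, φ X Y = - φ Y X) (X Y : ℰ²) :
    φ X Y = (X 0 * Y 1 - X 1 * Y 0) *
      φ (EuclideanSpace.single 0 1) (EuclideanSpace.single 1 1) := by
  have hdec : ∀ V : ℰ², V = V 0 • EuclideanSpace.single 0 1 + V 1 • EuclideanSpace.single 1 1 := by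
    intro V
    ext i
    fin_cases i <;> simp
  have h0 : φ (EuclideanSpace.single 0 1) (EuclideanSpace.single 0 1) = 0 := by
    linarith [hskew (EuclideanSpace.single 0 1) (EuclideanSpace.single 0 1)]
  have h1 : φ (EuclideanSpace.single 1 1) (EuclideanSpace.single 1 1) = 0 := by
    linarith [hskew (EuclideanSpace.single 1 1) (EuclideanSpace.single 1 1)]
  have hY : ∀ V, φ V Y = Y 0 * φ V (EuclideanSpace.single 0 1)
      + Y 1 * φ V (EuclideanSpace.single 1 1) := by
    intro V
    rw [hskew V Y]
    nth_rewrite 1 [hdec Y]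
    rw [hadd, hsmul, hsmul, hskew V (EuclideanSpace.single 0 1),
      hskew V (EuclideanSpace.single 1 1)]
    ring
  nth_rewrite 1 [hdec X]
  rw [hadd, hsmul, hsmul, hY, hY, h0, h1,
    hskew (EuclideanSpace.single 1 1) (EuclideanSpace.single 0 1)]
  ring

/-- Every two-dimensional metric satisfies `R = K G` pointwise. -/
theorem exists_riem_eq_plane {h : ℰ² → ℰ² →L[ℝ] ℰ² →L[ℝ] ℝ} {u : ℰ²} (hm : IsMetricNear h u) :
    ∃ K : ℝ, ∀ X Y Z W, riem h u X Y Z W = K * tensorG h u X Y Z W := by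
  have hR : ∀ X Y Z W, riem h u X Y Z W = (X 0 * Y 1 - X 1 * Y 0) * ((Z 0 * W 1 - Z 1 * W 0) *
      riem h u (EuclideanSpace.single 0 1) (EuclideanSpace.single 1 1)
        (EuclideanSpace.single 0 1) (EuclideanSpace.single 1 1)) := by
    intro X Y Z W
    rw [skew_plane_apply (φ := fun X Y => riem h u X Y Z W)
      (fun X X' Y => by simp only [riem, curvOp, map_add, map_sub, add_apply, sub_apply]; ring)
      (fun c X Y => by
        simp only [riem, curvOp, map_add, map_sub, map_smul, add_apply, sub_apply, smul_apply,
          smul_eq_mul]; ring)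
      (fun X Y => riem_skew_left h u X Y Z W),
      skew_plane_apply (φ := fun Z W => riem h u _ _ Z W)
      (fun X X' Y => by simp only [riem, curvOp, map_add, map_sub, add_apply, sub_apply]; ring)
      (fun c X Y => by
        simp only [riem, curvOp, map_add, map_sub, map_smul, add_apply, sub_apply, smul_apply,
          smul_eq_mul]; ring)
      (fun Z W => hm.riem_skew_right _ _ Z W) Z W]
  have hG : ∀ X Y Z W, tensorG h u X Y Z W = (X 0 * Y 1 - X 1 * Y 0) * ((Z 0 * W 1 - Z 1 * W 0) *
      tensorG h u (EuclideanSpace.single 0 1) (EuclideanSpace.single 1 1)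
        (EuclideanSpace.single 0 1) (EuclideanSpace.single 1 1)) := by
    intro X Y Z W
    rw [skew_plane_apply (φ := fun X Y => tensorG h u X Y Z W)
      (fun X X' Y => by simp only [tensorG_apply, map_add, add_apply]; ring)
      (fun c X Y => by simp only [tensorG_apply, map_smul, smul_apply, smul_eq_mul]; ring)
      (fun X Y => by simp only [tensorG_apply]; ring),
      skew_plane_apply (φ := fun Z W => tensorG h u _ _ Z W)
      (fun X X' Y => by simp only [tensorG_apply, map_add]; ring)
      (fun c X Y => by simp only [tensorG_apply, map_smul, smul_eq_mul]; ring)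
      (fun Z W => by simp only [tensorG_apply]; ring) Z W]
  have hli : LinearIndependent ℝ ![(EuclideanSpace.single 0 1 : ℰ²), EuclideanSpace.single 1 1] := by
    rw [LinearIndependent.pair_iff]
    intro s t hst
    have h0 := congrArg (fun v : ℰ² => v 0) hst
    have h1 := congrArg (fun v : ℰ² => v 1) hst
    simp at h0 h1
    exact ⟨h0, h1⟩
  obtain ⟨Z, W, hne⟩ := exists_tensorG_ne_zero hm.invertible hli
  rw [hG] at hne
  have hne' := right_ne_zero_of_mul (right_ne_zero_of_mul hne)
  refine ⟨riem h u (EuclideanSpace.single 0 1) (EuclideanSpace.single 1 1)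
      (EuclideanSpace.single 0 1) (EuclideanSpace.single 1 1) /
    tensorG h u (EuclideanSpace.single 0 1) (EuclideanSpace.single 1 1)
      (EuclideanSpace.single 0 1) (EuclideanSpace.single 1 1), fun X Y Z W => ?_⟩
  rw [hR X Y Z W, hG X Y Z W, mul_left_comm (_ / _), mul_left_comm (_ / _), div_mul_cancel₀ _ hne']

end Plane

/-! ### Coordinate expressions of metrics on manifolds -/

section Charts

variable {E : Type*} [NormedAddCommGroup E] [NormedSpace ℝ E]
  {H : Type*} [TopologicalSpace H] {I : ModelWithCorners ℝ E H}
  {M : Type*} [TopologicalSpace M] [ChartedSpace H M]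
  {E' : Type*} [NormedAddCommGroup E'] [NormedSpace ℝ E']
  {H' : Type*} [TopologicalSpace H'] {J : ModelWithCorners ℝ E' H'}
  {N : Type*} [TopologicalSpace N] [ChartedSpace H' N]

/-- The differential of the inverse of the preferred chart at `P`, as an endomorphism of the
coordinate space, with which all the tangent spaces are identified. -/
noncomputable def chartSymmDeriv (I : ModelWithCorners ℝ E H) (P : M) (u : E) : E →L[ℝ] E :=
  mfderiv 𝓘(ℝ, E) I (extChartAt I P).symm u

/-- A field of bilinear forms at a point, on the coordinate space. -/
def formAt (g : BilinField I M) (x : M) : E →L[ℝ] E →L[ℝ] ℝ := g x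

theorem localMetric_apply (g : BilinField I M) (P : M) (u v w : E) :
    localMetric I g P u v w = formAt g ((extChartAt I P).symm u)
      (chartSymmDeriv I P u v) (chartSymmDeriv I P u w) := rfl

theorem formAt_warped (g₁ : BilinField I M) (F : M → ℝ) (g₂ : BilinField J N) (x : M × N)
    (v w : E × E') : formAt (warped I J g₁ F g₂) x v w =
      formAt g₁ x.1 v.1 w.1 + F x.1 * formAt g₂ x.2 v.2 w.2 := rfl

/-- The differential of an inverse chart is the derivative of the change of coordinates to the
preferred chart at the image point. -/
theorem hasFDerivAt_extChartAt_symm [I.Boundaryless] [IsManifold I ∞ M] (P : M) {u : E}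
    (hu : u ∈ (extChartAt I P).target) :
    HasFDerivAt (fun v => extChartAt I ((extChartAt I P).symm u) ((extChartAt I P).symm v))
      (chartSymmDeriv I P u) u := by
  have hd : MDifferentiableAt 𝓘(ℝ, E) I (extChartAt I P).symm u :=
    ((contMDiffOn_extChartAt_symm (n := ∞) P).contMDiffAt
      ((isOpen_extChartAt_target P).mem_nhds hu)).mdifferentiableAt (by simp)
  have h : HasFDerivWithinAt (fun v => extChartAt I ((extChartAt I P).symm u)
      ((extChartAt I P).symm v)) (chartSymmDeriv I P u) (Set.range 𝓘(ℝ, E)) u :=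
    hd.hasMFDerivAt.2
  rwa [ModelWithCorners.range_eq_univ, hasFDerivWithinAt_univ] at h

theorem chartSymmDeriv_self [IsManifold I ∞ M] [I.Boundaryless] (P : M) :
    chartSymmDeriv I P (extChartAt I P P) = ContinuousLinearMap.id ℝ E := by
  have hP := mem_extChartAt_target (I := I) P
  refine (hasFDerivAt_extChartAt_symm P hP).unique ((hasFDerivAt_id _).congr_of_eventuallyEq ?_)
  filter_upwards [(isOpen_extChartAt_target P).mem_nhds hP] with v hv
  rw [extChartAt_to_inv]
  exact (extChartAt I P).right_inv hv

/-- The charts of a product are products of charts, so that the coordinate expression of a warped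
product is the warped product of the coordinate expressions. -/
theorem localMetric_warped [I.Boundaryless] [IsManifold I ∞ M] [J.Boundaryless] [IsManifold J ∞ N]
    (g₁ : BilinField I M) (F : M → ℝ) (g₂ : BilinField J N) (P : M × N)
    {u : E × E'} (hu : u ∈ (extChartAt (I.prod J) P).target) :
    localMetric (I.prod J) (warped I J g₁ F g₂) P u =
      localWarped (localMetric I g₁ P.1) (fun v => F ((extChartAt I P.1).symm v))
        (localMetric J g₂ P.2) u := by
  have h0 := hasFDerivAt_extChartAt_symm P hu
  have hu' : u.1 ∈ (extChartAt I P.1).target ∧ u.2 ∈ (extChartAt J P.2).target := by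
    rw [extChartAt_prod] at hu
    exact hu
  have h1 := hasFDerivAt_extChartAt_symm P.1 hu'.1
  have h2 := hasFDerivAt_extChartAt_symm P.2 hu'.2
  have h3 := h0.unique (((h1.comp u hasFDerivAt_fst).prodMk (h2.comp u hasFDerivAt_snd)
    ).congr_of_eventuallyEq (Filter.Eventually.of_forall fun v => by
      simp only [extChartAt_prod]
      rfl))
  refine ContinuousLinearMap.ext fun v => ContinuousLinearMap.ext fun w => ?_
  rw [localWarped_apply, localMetric_apply, localMetric_apply, localMetric_apply, h3,
    formAt_warped, extChartAt_prod]
  rfl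

theorem IsSemiRiemannian.isMetricNear [I.Boundaryless] [IsManifold I ∞ M] [FiniteDimensional ℝ E]
    {g : BilinField I M} (hg : IsSemiRiemannian I g) (P : M) :
    IsMetricNear (localMetric I g P) (extChartAt I P P) where
  contDiffAt := ((hg.smooth P).contDiffAt (extChartAt_target_mem_nhds P)).of_le
    (WithTop.coe_le_coe.2 le_top)
  symm := Filter.Eventually.of_forall fun u v w => by
    rw [localMetric_apply, localMetric_apply]
    exact hg.symm _ _ _
  invertible := by
    refine isInvertible_of_nondegenerate _ fun v hv => ?_
    have hv' : ∀ w, formAt g P v w = 0 := fun w => by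
      have hw := hv w
      rwa [localMetric_apply, chartSymmDeriv_self, extChartAt_to_inv] at hw
    exact hg.nondegenerate P v hv'

end Charts

section Plane

variable (U : TopologicalSpace.Opens (EuclideanSpace ℝ (Fin 2)))

theorem extChartAt_opens_symm (x : U) {u : EuclideanSpace ℝ (Fin 2)}
    (hu : u ∈ (extChartAt (𝓡 2) x).target) : ((extChartAt (𝓡 2) x).symm u : U).1 = u :=
  (extChartAt (𝓡 2) x).right_inv hu

/-- The charts of `U` are restrictions of the identity, so that the coordinate expression of
`diagMetric` is `diagForm`. -/
theorem localMetric_diagMetric (α β : EuclideanSpace ℝ (Fin 2) → ℝ) (x : U)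
    {u : EuclideanSpace ℝ (Fin 2)} (hu : u ∈ (extChartAt (𝓡 2) x).target) :
    localMetric (𝓡 2) (diagMetric U α β) x u = diagForm (α u) (β u) := by
  have h0 := hasFDerivAt_extChartAt_symm x hu
  have h1 := h0.unique ((hasFDerivAt_id u).congr_of_eventuallyEq (by
    filter_upwards [(isOpen_extChartAt_target x).mem_nhds hu] with v hv
    exact extChartAt_opens_symm U x hv))
  refine ContinuousLinearMap.ext fun v => ContinuousLinearMap.ext fun w => ?_
  rw [localMetric_apply, h1]
  change diagForm (α ((extChartAt (𝓡 2) x).symm u : U).1)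
    (β ((extChartAt (𝓡 2) x).symm u : U).1) v w = _
  rw [extChartAt_opens_symm U x hu]

end Plane

/-! ### Pseudosymmetry from the form of the curvature tensor -/

section SplitManifold

variable {E : Type*} [NormedAddCommGroup E] [NormedSpace ℝ E]
  {H : Type*} [TopologicalSpace H] {I : ModelWithCorners ℝ E H}
  {M : Type*} [TopologicalSpace M] [ChartedSpace H M] {g : BilinField I M}

/-- The curvature tensor of `g` is `l G + μ G(P·, P·, ·, ·)` with `μ` nowhere zero, for an
orthogonal projection `P` whose rank is at least two and which is not the identity. Here `e`
witnesses that `P` is not the identity, and `v`, `w` span a plane in the image of `P`. -/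
structure HasSplitCurvatureField (I : ModelWithCorners ℝ E H) (g : BilinField I M) (P : E →ₗ[ℝ] E)
    (l : ℝ) (μ : M → ℝ) (e v w : E) : Prop where
  split : ∀ x, HasSplitCurvature (localMetric I g x) (extChartAt I x x) P l (μ x)
  ne_zero : ∀ x, μ x ≠ 0
  e_ne : e ≠ 0
  map_e : P e = 0
  map_v : P v = v
  map_w : P w = w
  linearIndependent : LinearIndependent ℝ ![v, w]

namespace HasSplitCurvatureField

variable {P : E →ₗ[ℝ] E} {l : ℝ} {μ : M → ℝ} {e v w : E}

theorem RdotRAt_eq (hs : HasSplitCurvatureField I g P l μ e v w) (x : M) :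
    RdotRAt I g x = l • tachibanaAt I g x :=
  (hs.split x).RdotR_eq

theorem tachibanaAt_ne_zero (hs : HasSplitCurvatureField I g P l μ e v w) (x : M) :
    tachibanaAt I g x ≠ 0 := by
  obtain ⟨e', he', hee'⟩ := (hs.split x).exists_apply_ne_zero hs.map_e hs.e_ne
  obtain ⟨s, t, hst⟩ := exists_tensorG_ne_zero (hs.split x).invertible hs.linearIndependent
  intro h0
  have h1 : tachibanaAt I g x e w s t e' v = 0 := by rw [h0]; rfl
  have h2 := (hs.split x).tachibana_eq (w := w) (s := s) (t := t) hs.map_e he' hs.map_v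
  rw [hs.map_w] at h2
  exact mul_ne_zero (mul_ne_zero (hs.ne_zero x) hee') hst (h2.symm.trans h1)

variable [FiniteDimensional ℝ E]

/-- The value of `L_R - κ / (n(n-1))`. -/
theorem sub_scalarAt_div (hs : HasSplitCurvatureField I g P l μ e v w)
    (hn : (Module.finrank ℝ E : ℝ) * (Module.finrank ℝ E - 1) ≠ 0) (x : M) :
    l - scalarAt I g x / ((Module.finrank ℝ E : ℝ) * (Module.finrank ℝ E - 1)) =
      -(μ x * (LinearMap.trace ℝ E P * (LinearMap.trace ℝ E P - 1)) /
        ((Module.finrank ℝ E : ℝ) * (Module.finrank ℝ E - 1))) := by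
  rw [scalarAt, (hs.split x).scalar_eq, add_div, mul_div_cancel_right₀ _ hn, sub_add_cancel_left]

theorem setUR_eq_univ (hs : HasSplitCurvatureField I g P l μ e v w)
    (hn : (Module.finrank ℝ E : ℝ) * (Module.finrank ℝ E - 1) ≠ 0)
    (hm : LinearMap.trace ℝ E P * (LinearMap.trace ℝ E P - 1) ≠ 0) :
    setUR I g = Set.univ := by
  refine Set.eq_univ_of_forall fun x h0 => ?_
  obtain ⟨e', he', hee'⟩ := (hs.split x).exists_apply_ne_zero hs.map_e hs.e_ne
  have hv : v ≠ 0 := hs.linearIndependent.ne_zero 0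
  obtain ⟨t, ht⟩ : ∃ t, localMetric I g x (extChartAt I x x) v t ≠ 0 := by
    by_contra! hc
    exact hv (nondegenerate_of_isInvertible (hs.split x).invertible hc)
  have h1 := (hs.split x).riem_sub_apply (t := t) hs.map_e he' hs.map_v
    (scalarAt I g x / ((Module.finrank ℝ E : ℝ) * (Module.finrank ℝ E - 1)))
  have h2 := congrFun (congrFun (congrFun (congrFun h0 e) v) t) e'
  refine mul_ne_zero ?_ (mul_ne_zero hee' ht) (h1.symm.trans h2)
  rw [hs.sub_scalarAt_div hn]
  exact neg_ne_zero.2 (div_ne_zero (mul_ne_zero (hs.ne_zero x) hm) hn)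

theorem isFunctionLR_iff (hs : HasSplitCurvatureField I g P l μ e v w)
    (hU : setUR I g = Set.univ) (L : M → ℝ) : IsFunctionLR I g L ↔ ∀ x, L x = l := by
  constructor
  · intro hL x
    have h1 := hL x (by rw [hU]; trivial)
    rw [hs.RdotRAt_eq x] at h1
    exact (smul_left_injective ℝ (hs.tachibanaAt_ne_zero x) h1).symm
  · intro hL x _
    rw [hL x, hs.RdotRAt_eq x]

theorem isPseudosymmetricOfConstantType (hs : HasSplitCurvatureField I g P l μ e v w)
    (hg : IsSemiRiemannian I g) : IsPseudosymmetricOfConstantType I g := by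
  refine ⟨⟨hg, fun x hli => ?_⟩, l, fun x _ => hs.RdotRAt_eq x⟩
  rw [LinearIndependent.pair_iff] at hli
  exact one_ne_zero (hli 1 (-l) (by rw [hs.RdotRAt_eq x]; simp)).1

end HasSplitCurvatureField

end SplitManifold

/-! ### The fibre -/

section Fibre

/-- `R̃ = K G̃` at every point of the fibre, with `K` determined by the scalar curvature. If the fibre
is a surface, `K` may depend on the point. -/
theorem riemAt_eq_of_const_or_plane {m : ℕ} (hm : 2 ≤ m)
    {N : Type*} [TopologicalSpace N] [ChartedSpace (EuclideanSpace ℝ (Fin m)) N]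
    [IsManifold (𝓡 m) ∞ N] {gN : BilinField (𝓡 m) N} (hgN : IsSemiRiemannian (𝓡 m) gN)
    (hconst : 3 ≤ m → IsConstantCurvature (𝓡 m) gN) (y : N) (X Y Z W : EuclideanSpace ℝ (Fin m)) :
    riem (localMetric (𝓡 m) gN y) (extChartAt (𝓡 m) y y) X Y Z W =
      scalarAt (𝓡 m) gN y / ((m : ℝ) * (m - 1)) *
        tensorG (localMetric (𝓡 m) gN y) (extChartAt (𝓡 m) y y) X Y Z W := by
  have hmet := hgN.isMetricNear y
  obtain ⟨K, hK⟩ : ∃ K : ℝ, ∀ X Y Z W,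
      riem (localMetric (𝓡 m) gN y) (extChartAt (𝓡 m) y y) X Y Z W =
        K * tensorG (localMetric (𝓡 m) gN y) (extChartAt (𝓡 m) y y) X Y Z W := by
    rcases Nat.lt_or_ge m 3 with h | h
    · obtain rfl : m = 2 := by omega
      exact exists_riem_eq_plane hmet
    · obtain ⟨K, hK⟩ := hconst h
      exact ⟨K, fun X Y Z W => congrFun (congrFun (congrFun (congrFun (hK y) X) Y) Z) W⟩
  have hs : scalarAt (𝓡 m) gN y = K * ((m : ℝ) * (m - 1)) := by
    have := (HasSplitCurvature.of_riem_eq hmet hK).scalar_eq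
    simpa [scalarAt] using this
  have hm' : (2 : ℝ) ≤ m := by exact_mod_cast hm
  have hne : (m : ℝ) * (m - 1) ≠ 0 := mul_ne_zero (by linarith) (by linarith)
  rw [hs, mul_div_cancel_right₀ _ hne, hK]

end Fibre

/-! ### The warped products of the theorem -/

section Product

local notation "ℰ²" => EuclideanSpace ℝ (Fin 2)

variable {m : ℕ} {U : TopologicalSpace.Opens (EuclideanSpace ℝ (Fin 2))}
  {N : Type*} [TopologicalSpace N] [ChartedSpace (EuclideanSpace ℝ (Fin m)) N]
  {a b B : ℝ → ℝ} {C D : ℝ} {gN : BilinField (𝓡 m) N}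

/-- The metric `a (dx¹)² + b (dx²)² + b B² g̃`. -/
noncomputable def warpedOverPlane (m : ℕ) (U : TopologicalSpace.Opens (EuclideanSpace ℝ (Fin 2)))
    {N : Type*} [TopologicalSpace N] [ChartedSpace (EuclideanSpace ℝ (Fin m)) N]
    (a b B : ℝ → ℝ) (gN : BilinField (𝓡 m) N) : BilinField ((𝓡 2).prod (𝓡 m)) (U × N) :=
  warped (𝓡 2) (𝓡 m) (diagMetric U (fun x => a (x 0)) (fun x => b (x 0)))
    (fun x => warpFun b B x.1) gN

/-- The projection onto the tangent space of the fibre. -/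
noncomputable def fibreProj (m : ℕ) :
    (ℰ² × EuclideanSpace ℝ (Fin m)) →ₗ[ℝ] (ℰ² × EuclideanSpace ℝ (Fin m)) :=
  LinearMap.inr ℝ ℰ² (EuclideanSpace ℝ (Fin m)) ∘ₗ LinearMap.snd ℝ ℰ² (EuclideanSpace ℝ (Fin m))

theorem fibreProj_apply (v : ℰ² × EuclideanSpace ℝ (Fin m)) : fibreProj m v = (0, v.2) := rfl

theorem trace_fibreProj : LinearMap.trace ℝ _ (fibreProj m) = m := by
  rw [fibreProj, LinearMap.trace_comp_comm']
  have : LinearMap.snd ℝ ℰ² (EuclideanSpace ℝ (Fin m)) ∘ₗ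
      LinearMap.inr ℝ ℰ² (EuclideanSpace ℝ (Fin m)) = LinearMap.id := by
    ext; simp
  rw [this, LinearMap.trace_id]
  simp

theorem mem_of_mem_target {P : U × N} {u : ℰ² × EuclideanSpace ℝ (Fin m)}
    (hu : u ∈ (extChartAt ((𝓡 2).prod (𝓡 m)) P).target) :
    u.1 ∈ U ∧ u.2 ∈ (extChartAt (𝓡 m) P.2).target := by
  rw [extChartAt_prod] at hu
  refine ⟨?_, hu.2⟩
  rw [← extChartAt_opens_symm U P.1 hu.1]
  exact Subtype.coe_prop _

variable [IsManifold (𝓡 m) ∞ N]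

theorem localMetric_warpedOverPlane (P : U × N) {u : ℰ² × EuclideanSpace ℝ (Fin m)}
    (hu : u ∈ (extChartAt ((𝓡 2).prod (𝓡 m)) P).target) :
    localMetric ((𝓡 2).prod (𝓡 m)) (warpedOverPlane m U a b B gN) P u =
      localWarped (fun x : ℰ² => diagForm (a (x 0)) (b (x 0))) (warpFun b B)
        (localMetric (𝓡 m) gN P.2) u := by
  have hu' : u.1 ∈ (extChartAt (𝓡 2) P.1).target := by
    rw [extChartAt_prod] at hu
    exact hu.1
  rw [warpedOverPlane, localMetric_warped _ _ _ _ hu]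
  refine ContinuousLinearMap.ext fun v => ContinuousLinearMap.ext fun w => ?_
  rw [localWarped_apply, localWarped_apply, localMetric_diagMetric U _ _ _ hu',
    extChartAt_opens_symm U _ hu']

theorem isSemiRiemannian_warpedOverPlane (hU : ∀ x ∈ U, BaseData a b B C D x)
    (hgN : IsSemiRiemannian (𝓡 m) gN) :
    IsSemiRiemannian ((𝓡 2).prod (𝓡 m)) (warpedOverPlane m U a b B gN) where
  symm P v w := congrArg₂ (· + ·) (diagForm_symm _ _ v.1 w.1)
    (congrArg (warpFun b B P.1 * ·) (hgN.symm P.2 v.2 w.2))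
  nondegenerate P v hv :=
    localWarped_nondegenerate (A₁ := diagForm (a (P.1.1 0)) (b (P.1.1 0)))
      (A₂ := formAt gN P.2) (f := warpFun b B P.1)
      (diagForm_nondegenerate (hU _ P.1.2).a_ne (hU _ P.1.2).b_ne)
      (fun v hv => hgN.nondegenerate P.2 v hv) (hU _ P.1.2).warpFun_ne hv
  smooth P := by
    refine ContDiffOn.congr (fun u hu => ?_) fun u hu => localMetric_warpedOverPlane P hu
    obtain ⟨hu1, hu2⟩ := mem_of_mem_target hu
    exact (contDiffAt_localWarped (contDiffAt_diagForm
      (contDiffAt_comp_coord 0 (hU _ hu1).contDiffAt_a)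
      (contDiffAt_comp_coord 0 (hU _ hu1).contDiffAt_b))
      (contDiffAt_warpFun (hU _ hu1).contDiffAt_b (hU _ hu1).contDiffAt_B)
      ((hgN.smooth P.2).contDiffAt
        ((isOpen_extChartAt_target P.2).mem_nhds hu2))).contDiffWithinAt

theorem hasSplitCurvature_warpedOverPlane (hm : 2 ≤ m) (hU : ∀ x ∈ U, BaseData a b B C D x)
    (hgN : IsSemiRiemannian (𝓡 m) gN) (hconst : 3 ≤ m → IsConstantCurvature (𝓡 m) gN) (P : U × N) :
    HasSplitCurvature (localMetric ((𝓡 2).prod (𝓡 m)) (warpedOverPlane m U a b B gN) P)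
      (extChartAt ((𝓡 2).prod (𝓡 m)) P P) (fibreProj m) (-D / 4)
      ((scalarAt (𝓡 m) gN P.2 / ((m : ℝ) * (m - 1)) -
        (deriv B (P.1.1 1) ^ 2 - C * B (P.1.1 1) ^ 2)) / warpFun b B P.1.1) := by
  have hP : extChartAt ((𝓡 2).prod (𝓡 m)) P P = (P.1.1, extChartAt (𝓡 m) P.2 P.2) := by
    rw [extChartAt_prod]
    rfl
  have hev : localMetric ((𝓡 2).prod (𝓡 m)) (warpedOverPlane m U a b B gN) P
      =ᶠ[𝓝 (extChartAt ((𝓡 2).prod (𝓡 m)) P P)]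
      localWarped (fun x : ℰ² => diagForm (a (x 0)) (b (x 0))) (warpFun b B)
        (localMetric (𝓡 m) gN P.2) := by
    filter_upwards [extChartAt_target_mem_nhds P] with u hu
    exact localMetric_warpedOverPlane P hu
  have hbase := hU _ P.1.2
  have hmN := hgN.isMetricNear P.2
  have hw : IsMetricNear (localWarped (fun x : ℰ² => diagForm (a (x 0)) (b (x 0))) (warpFun b B)
      (localMetric (𝓡 m) gN P.2)) (P.1.1, extChartAt (𝓡 m) P.2 P.2) :=
    IsMetricNear.localWarped hbase.isMetricNear
      (contDiffAt_warpFun hbase.contDiffAt_b_two hbase.contDiffAt_B_two) hbase.warpFun_ne hmN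
  have hw' := hw
  rw [← hP] at hw'
  have hmet := hw'.congr hev
  have hF := hbase.warpFun_ne
  refine ⟨hmet.symm_self, hmet.invertible, fun v => rfl, fun v w => ?_, fun X Y Z W => ?_⟩
  · rw [hev.eq_of_nhds, hP]
    simp only [localWarped_apply, fibreProj_apply, map_zero, zero_apply, zero_add]
  · rw [riem_congr hev, tensorG_congr hev, hP, BaseData.riem_warped hbase hmN
      (riemAt_eq_of_const_or_plane hm hgN hconst P.2)]
    simp only [tensorG_apply, localWarped_apply, fibreProj_apply, map_zero, zero_apply, zero_add]
    field_simp

theorem hasSplitCurvatureField_warpedOverPlane (hm : 2 ≤ m) (hU : ∀ x ∈ U, BaseData a b B C D x)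
    (hgN : IsSemiRiemannian (𝓡 m) gN) (hconst : 3 ≤ m → IsConstantCurvature (𝓡 m) gN)
    (hne : ∀ x ∈ U, ∀ y : N, scalarAt (𝓡 m) gN y / ((m : ℝ) * (m - 1)) ≠
      deriv B (x 1) ^ 2 - C * B (x 1) ^ 2) :
    HasSplitCurvatureField ((𝓡 2).prod (𝓡 m)) (warpedOverPlane m U a b B gN) (fibreProj m) (-D / 4)
      (fun P => (scalarAt (𝓡 m) gN P.2 / ((m : ℝ) * (m - 1)) -
        (deriv B (P.1.1 1) ^ 2 - C * B (P.1.1 1) ^ 2)) / warpFun b B P.1.1)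
      (EuclideanSpace.single 0 1, 0) (0, EuclideanSpace.single ⟨0, by omega⟩ 1)
      (0, EuclideanSpace.single ⟨1, by omega⟩ 1) where
  split := hasSplitCurvature_warpedOverPlane hm hU hgN hconst
  ne_zero P := div_ne_zero (sub_ne_zero.2 (hne _ P.1.2 _)) (hU _ P.1.2).warpFun_ne
  e_ne h0 := by
    have := congrArg (fun v : ℰ² × EuclideanSpace ℝ (Fin m) => v.1 0) h0
    simp at this
  map_e := rfl
  map_v := rfl
  map_w := rfl
  linearIndependent := by
    rw [LinearIndependent.pair_iff]
    intro s t hst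
    have h0 := congrArg
      (fun v : ℰ² × EuclideanSpace ℝ (Fin m) => v.2 (⟨0, by omega⟩ : Fin m)) hst
    have h1 := congrArg
      (fun v : ℰ² × EuclideanSpace ℝ (Fin m) => v.2 (⟨1, by omega⟩ : Fin m)) hst
    simp at h0 h1
    exact ⟨h0, h1⟩

/-- The data of the second metric: `b̄ = p b / (1 + q b)`, `ā = p a / (1 + q b)²` and
`D̄ = (D + 4 q C) / p` are related as `b`, `a` and `D` are. -/
theorem BaseData.transform {u : ℰ²} {p q : ℝ} (h : BaseData a b B C D u) (hp : p ≠ 0)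
    (hq : 1 + q * b (u 0) ≠ 0) :
    BaseData (fun t => p * a t / (1 + q * b t) ^ 2) (fun t => p * b t / (1 + q * b t)) B C
      ((D + 4 * q * C) / p) u := by
  have hderiv : ∀ t, DifferentiableAt ℝ b t → 1 + q * b t ≠ 0 →
      deriv (fun t => p * b t / (1 + q * b t)) t = p * deriv b t / (1 + q * b t) ^ 2 := by
    intro t ht hqt
    have := ((ht.hasDerivAt.const_mul p).div ((ht.hasDerivAt.const_mul q).const_add 1) hqt).deriv
    refine this.trans ?_
    field_simp
    ring
  have hden : ∀ t, 1 + q * b t ≠ 0 →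
      (D + 4 * q * C) / p * (p * b t / (1 + q * b t)) - 4 * C =
        (D * b t - 4 * C) / (1 + q * b t) := by
    intro t hqt
    field_simp
    ring
  have hbd := h.contDiffAt_b.differentiableAt (by simp)
  refine ⟨?_, h.contDiffAt_B, ?_, ?_, ?_, h.B_ne, ?_, h.deriv_deriv_B⟩
  · exact (contDiffAt_const.mul h.contDiffAt_b).div
      (contDiffAt_const.add (contDiffAt_const.mul h.contDiffAt_b)) hq
  · exact div_ne_zero (mul_ne_zero hp h.b_ne) hq
  · rw [hderiv _ hbd hq]
    exact div_ne_zero (mul_ne_zero hp h.deriv_b_ne) (pow_ne_zero 2 hq)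
  · rw [hden _ hq]
    exact div_ne_zero h.denom_ne hq
  · have hqe : ∀ᶠ t in 𝓝 (u 0), 1 + q * b t ≠ 0 :=
      (continuousAt_const.add (continuousAt_const.mul hbd.continuousAt)).eventually_ne hq
    filter_upwards [h.a_eq, hqe, h.contDiffAt_b_two.eventually (by simp)] with t h1 h2 h3
    rw [hderiv _ (h3.differentiableAt (by norm_num)) h2, hden _ h2, h1]
    field_simp

/-- The projection of `U` to the first axis is open. Hence the formula which gives `a` on it can be
differentiated. -/
theorem eventually_exists_coord_eq {x : ℰ²} (hx : x ∈ U) :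
    ∀ᶠ t in 𝓝 (x 0), ∃ y ∈ U, y 0 = t := by
  have hc : ContinuousAt (fun t : ℝ => x + (t - x 0) • EuclideanSpace.single (0 : Fin 2) (1 : ℝ))
      (x 0) := by fun_prop
  have := hc.eventually (U.isOpen.mem_nhds (by simpa using hx))
  filter_upwards [this] with t ht
  exact ⟨_, ht, by simp⟩

end Product

end SemiRiem

open SemiRiem in
theorem proposition4p2
    (n : ℕ) (hn : 4 ≤ n)
    -- the base `M̂`: an open set `U` of the plane, with `ĝ = a(x¹)(dx¹)² + b(x¹)(dx²)²`
    (U : TopologicalSpace.Opens (EuclideanSpace ℝ (Fin 2)))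
    (a b B : ℝ → ℝ) (C D p q : ℝ)
    (hb_smooth : ∀ x ∈ U, ContDiffAt ℝ ∞ b (x 0))
    (hB_smooth : ∀ x ∈ U, ContDiffAt ℝ ∞ B (x 1))
    (hb : ∀ x ∈ U, b (x 0) ≠ 0)
    (hb' : ∀ x ∈ U, deriv b (x 0) ≠ 0)
    (hD : ∀ x ∈ U, D * b (x 0) - 4 * C ≠ 0)
    (ha : ∀ x ∈ U, a (x 0) = deriv b (x 0) ^ 2 / (b (x 0) * (D * b (x 0) - 4 * C)))
    (hB : ∀ x ∈ U, B (x 1) ≠ 0)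
    (hBC : ∀ x ∈ U, deriv (deriv B) (x 1) / B (x 1) = C)
    (hp : p ≠ 0)
    (hq : ∀ x ∈ U, 1 + q * b (x 0) ≠ 0)
    -- the fibre `Ñ`, of dimension `n - 2`, with its metric `g̃`
    {N : Type*} [TopologicalSpace N] [ChartedSpace (EuclideanSpace ℝ (Fin (n - 2))) N]
    [IsManifold (𝓡 (n - 2)) ∞ N]
    (gN : BilinField (𝓡 (n - 2)) N)
    (hgN : IsSemiRiemannian (𝓡 (n - 2)) gN)
    (hconst : 5 ≤ n → IsConstantCurvature (𝓡 (n - 2)) gN)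
    (hne : ∀ x ∈ U, ∀ y : N, scalarAt (𝓡 (n - 2)) gN y / (((n : ℝ) - 3) * ((n : ℝ) - 2)) ≠
      deriv B (x 1) ^ 2 - C * B (x 1) ^ 2)
    -- the warped products `(M, g)` and `(M̄, ḡ)`
    (g gbar : BilinField ((𝓡 2).prod (𝓡 (n - 2))) (U × N))
    (hg : g = warped (𝓡 2) (𝓡 (n - 2))
      (diagMetric U (fun x => a (x 0)) (fun x => b (x 0)))
      (fun x => b (x.1 0) * B (x.1 1) ^ 2) gN)
    (hgbar : gbar = warped (𝓡 2) (𝓡 (n - 2))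
      (diagMetric U (fun x => p * a (x 0) / (1 + q * b (x 0)) ^ 2)
        (fun x => p * b (x 0) / (1 + q * b (x 0))))
      (fun x => p / (1 + q * b (x.1 0)) * (b (x.1 0) * B (x.1 1) ^ 2)) gN) :
    -- `L_R` and `L_R̄` are functions on the whole manifold, equal to the stated constants
    (setUR ((𝓡 2).prod (𝓡 (n - 2))) g = Set.univ ∧
      ∀ L : U × N → ℝ, IsFunctionLR ((𝓡 2).prod (𝓡 (n - 2))) g L ↔ ∀ P, L P = -D / 4) ∧
    (setUR ((𝓡 2).prod (𝓡 (n - 2))) gbar = Set.univ ∧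
      ∀ L : U × N → ℝ, IsFunctionLR ((𝓡 2).prod (𝓡 (n - 2))) gbar L ↔
        ∀ P, L P = -(D + 4 * q * C) / (4 * p)) ∧
    IsPseudosymmetricOfConstantType ((𝓡 2).prod (𝓡 (n - 2))) g ∧
    IsPseudosymmetricOfConstantType ((𝓡 2).prod (𝓡 (n - 2))) gbar ∧
    ∀ L Lbar : U × N → ℝ,
      IsFunctionLR ((𝓡 2).prod (𝓡 (n - 2))) g L →
      IsFunctionLR ((𝓡 2).prod (𝓡 (n - 2))) gbar Lbar →
      ∀ P : U × N,
        L P - scalarAt ((𝓡 2).prod (𝓡 (n - 2))) g P / ((n : ℝ) * ((n : ℝ) - 1)) =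
          p / (1 + q * b (P.1.1 0)) *
            (Lbar P - scalarAt ((𝓡 2).prod (𝓡 (n - 2))) gbar P / ((n : ℝ) * ((n : ℝ) - 1))) := by
  have hm : 2 ≤ n - 2 := by omega
  have hmn : ((n - 2 : ℕ) : ℝ) = n - 2 := by
    rw [Nat.cast_sub (by omega)]
    norm_num
  have hn4 : (4 : ℝ) ≤ n := by exact_mod_cast hn
  have hrank : (Module.finrank ℝ (EuclideanSpace ℝ (Fin 2) × EuclideanSpace ℝ (Fin (n - 2))) : ℝ)
      = n := by
    rw [Module.finrank_prod, finrank_euclideanSpace_fin, finrank_euclideanSpace_fin]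
    push_cast
    rw [hmn]
    ring
  have hn0 : (n : ℝ) * (n - 1) ≠ 0 := mul_ne_zero (by linarith) (by linarith)
  have hm0 : ((n : ℝ) - 2) * (n - 2 - 1) ≠ 0 := mul_ne_zero (by linarith) (by linarith)
  have hbase : ∀ x ∈ U, BaseData a b B C D x := fun x hx =>
    ⟨hb_smooth x hx, hB_smooth x hx, hb x hx, hb' x hx, hD x hx, hB x hx,
      (eventually_exists_coord_eq hx).mono fun t ⟨y, hy, hyt⟩ => by rw [← hyt]; exact ha y hy,
      (div_eq_iff (hB x hx)).1 (hBC x hx)⟩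
  have hbase' := fun x hx => (hbase x hx).transform hp (hq x hx)
  have hconst' : 3 ≤ n - 2 → IsConstantCurvature (𝓡 (n - 2)) gN := fun h => hconst (by omega)
  have hne' : ∀ x ∈ U, ∀ y : N,
      scalarAt (𝓡 (n - 2)) gN y / (((n - 2 : ℕ) : ℝ) * (((n - 2 : ℕ) : ℝ) - 1)) ≠
        deriv B (x 1) ^ 2 - C * B (x 1) ^ 2 := by
    intro x hx y
    have := hne x hx y
    rwa [hmn, mul_comm, sub_sub, show (2 : ℝ) + 1 = 3 by norm_num]
  have hg' : g = warpedOverPlane (n - 2) U a b B gN := hg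
  have hgbar' : gbar = warpedOverPlane (n - 2) U (fun t => p * a t / (1 + q * b t) ^ 2)
      (fun t => p * b t / (1 + q * b t)) B gN := by
    rw [hgbar, warpedOverPlane]
    congr 1
    funext x
    rw [warpFun]
    ring
  have hs := hasSplitCurvatureField_warpedOverPlane hm hbase hgN hconst' hne'
  have hs' := hasSplitCurvatureField_warpedOverPlane hm hbase' hgN hconst' hne'
  rw [← hg'] at hs
  rw [← hgbar'] at hs'
  have hUR := hs.setUR_eq_univ (by rwa [hrank]) (by rwa [trace_fibreProj, hmn])
  have hUR' := hs'.setUR_eq_univ (by rwa [hrank]) (by rwa [trace_fibreProj, hmn])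
  have hL' : -((D + 4 * q * C) / p) / 4 = -(D + 4 * q * C) / (4 * p) := by
    field_simp
  refine ⟨⟨hUR, hs.isFunctionLR_iff hUR⟩, ⟨hUR', ?_⟩, hs.isPseudosymmetricOfConstantType ?_,
    hs'.isPseudosymmetricOfConstantType ?_, ?_⟩
  · rw [← hL']
    exact hs'.isFunctionLR_iff hUR'
  · rw [hg']
    exact isSemiRiemannian_warpedOverPlane hbase hgN
  · rw [hgbar']
    exact isSemiRiemannian_warpedOverPlane hbase' hgN
  · intro L Lbar hL hLbar P
    have h4 := hs.sub_scalarAt_div (by rwa [hrank]) P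
    have h5 := hs'.sub_scalarAt_div (by rwa [hrank]) P
    rw [hrank] at h4 h5
    rw [(hs.isFunctionLR_iff hUR L).1 hL P, (hs'.isFunctionLR_iff hUR' Lbar).1 hLbar P,
      h4, h5, warpFun, warpFun]
    have h1 := hb _ P.1.2
    have h2 := hB _ P.1.2
    have h3 := hq _ P.1.2
    -- the factors `μ` of the two metrics are inversely proportional to the warping functions
    have key : ∀ s X Y Z : ℝ, s ≠ 0 → -(X / (b (P.1.1 0) * B (P.1.1 1) ^ 2) * Y / Z) =
        p / s * -(X / (p * b (P.1.1 0) / s * B (P.1.1 1) ^ 2) * Y / Z) := by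
      intro s X Y Z hs0
      field_simp
    exact key _ _ _ _ h3
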